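/- Let $M$ be a smooth manifold of dimension $n$, $F:TM\to\mathbb R$ a Finsler metric on $M$ (continuous on $TM$, positive and smooth on $TM\setminus 0$, positively $1$-homogeneous in $y$, with positive definite fundamental tensor $\langle u,v\rangle^F_y=\frac12\frac{\partial^2}{\partial s\,\partial t}\big|_{s=t=0}F^2(x,y+su+tv)$ for $y\in T_xM\setminus\{0\}$), and let $V$ be a smooth vector field on $M$ which is homothetic for $F$ with dilation $c\in\mathbb R$, i.e. the local flow $\Psi_t$ of $V$ satisfies $F(\Psi_t(x),(\Psi_t)_*y)=e^{-2ct}F(x,y)$ for all $y\in T_xM$ whenever $\Psi_t(x)$ is defined. Assume that $F(x,-V(x))>1$ for every $x\in M$. Let $\tilde F$ be the Lorentz Finsler metric induced by navigation with the datum $(F,V)$, i.e. the function defined on the set of all $\tilde y=y+F(x,y)V(x)$, where $y\in T_xM\setminus\{0\}$ and $\langle y,V(x)\rangle^F_y<-F(x,y)$, by $$\tilde F\bigl(x,y+F(x,y)V(x)\bigr)=F(x,y).$$ For a (conic pseudo-)Finsler metric $L$ and a smooth measure $\mathrm d\mu=\sigma(x)\,\mathrm dx^1\cdots\mathrm dx^n$,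 the S-curvature $S^L_{\mathrm d\mu}$ is the derivative of the distortion $\tau(x,y)=\ln\frac{\sqrt{|\det(g_{ij}(x,y))|}}{\sigma(x)}$, with $g_{ij}=\frac12[L^2]_{y^iy^j}$, in the direction of the geodesic spray $y^i\partial_{x^i}-2G^i\partial_{y^i}$, where $G^i=\frac14g^{il}\bigl([L^2]_{x^ky^l}y^k-[L^2]_{x^l}\bigr)$, in local coordinates $(x^i,y^i)$. Let $\mathrm d\mu^F_{\mathrm{BH}}$ be the Busemann–Hausdorff measure of $F$, whose density in local coordinates is $$\sigma(x)=\frac{\mathrm{Vol}\{(y^i):\sum_i (y^i)^2\le 1\}}{\mathrm{Vol}\{(y^i): F(x,y^i\partial_{x^i})\le 1\}},$$ with $\mathrm{Vol}$ the Lebesgue measure of $\mathbb R^n$. Then for every $x\in M$, every $y\in T_xM\setminus\{0\}$ with $\langle y,V(x)\rangle^F_y<-F(x,y)$, and $\tilde y=y+F(x,y)V(x)$, $$S^{\tilde F}_{\mathrm d\mu^F_{\mathrm{BH}}}(x,\tilde y)=S^{F}_{\mathrm d\mu^F_{\mathrm{BH}}}(x,y)+(n+1)\,c\,F(x,y).$$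 -/

import Mathlib

open scoped Manifold ContDiff
open MeasureTheory

noncomputable section

namespace FinslerNavigation

/-- `ℝⁿ` with its Euclidean structure, the model space of an `n`-dimensional manifold. -/
abbrev Coord (n : ℕ) : Type := EuclideanSpace ℝ (Fin n)

/-- The `i`-th standard basis vector of `ℝⁿ`. -/
def basisVec {n : ℕ} (i : Fin n) : Coord n := EuclideanSpace.single i (1 : ℝ)

/-- The fundamental tensor at `y` of a function `N` on a real vector space:
`⟨u, v⟩_y = (1/2) ∂²/∂s∂t N²(y + s u + t v)` at `s = t = 0`. -/
def fundTensor {W : Type*} [AddCommGroup W] [Module ℝ W] (N : W → ℝ) (y u v : W) : ℝ :=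
  (1 / 2) * deriv (fun s : ℝ => deriv (fun t : ℝ => N (y + s • u + t • v) ^ 2) 0) 0

/-! ### Finsler metrics, homothetic fields and navigation on a manifold -/

section Manifold

variable {n : ℕ} {M : Type*} [TopologicalSpace M] [ChartedSpace (Coord n) M]

/-- Finsler metrics on a smooth manifold `M`, as functions `F x y` of `x : M`, `y ∈ T_x M`. -/
structure IsFinslerMetric [IsManifold (𝓡 n) ∞ M]
    (F : ∀ x : M, TangentSpace (𝓡 n) x → ℝ) : Prop where
  continuous : Continuous (fun p : TangentBundle (𝓡 n) M => F p.1 p.2)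
  smooth : ContMDiffOn (𝓡 n).tangent 𝓘(ℝ, ℝ) ∞
    (fun p : TangentBundle (𝓡 n) M => F p.1 p.2) {p | p.2 ≠ 0}
  pos : ∀ (x : M) (y : TangentSpace (𝓡 n) x), y ≠ 0 → 0 < F x y
  homogeneous : ∀ (x : M) (y : TangentSpace (𝓡 n) x), y ≠ 0 →
    ∀ r : ℝ, 0 ≤ r → F x (r • y) = r * F x y
  /-- Strong convexity. Symmetry and bilinearity of the fundamental tensor at `y ≠ 0` are
  automatic, since `F` is smooth there. -/
  strong_convex : ∀ (x : M) (y : TangentSpace (𝓡 n) x), y ≠ 0 →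
    ∀ u : TangentSpace (𝓡 n) x, u ≠ 0 → 0 < fundTensor (F x) y u u

/-- `V` is homothetic for `F` with dilation `c`: around every point `V` generates a smooth local
flow `Ψ_t` with `F(Ψ_t(x), (Ψ_t)_* y) = e^{-2ct} F(x, y)` wherever this flow is defined. -/
def IsHomothetic (F : ∀ x : M, TangentSpace (𝓡 n) x → ℝ)
    (V : ∀ x : M, TangentSpace (𝓡 n) x) (c : ℝ) : Prop :=
  ∀ x₀ : M, ∃ (U : Set M) (ε : ℝ) (Ψ : ℝ → M → M),
    IsOpen U ∧ x₀ ∈ U ∧ 0 < ε ∧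
    ContMDiffOn (𝓘(ℝ, ℝ).prod (𝓡 n)) (𝓡 n) ∞ (fun p : ℝ × M => Ψ p.1 p.2)
      (Set.Ioo (-ε) ε ×ˢ U) ∧
    (∀ x ∈ U, Ψ 0 x = x) ∧
    (∀ x ∈ U, IsMIntegralCurveOn (I := 𝓡 n) (fun t => Ψ t x) V (Set.Ioo (-ε) ε)) ∧
    ∀ t ∈ Set.Ioo (-ε) ε, ∀ x ∈ U, ∀ y : TangentSpace (𝓡 n) x,
      F (Ψ t x) (mfderiv (𝓡 n) (𝓡 n) (Ψ t) x y) = Real.exp (-2 * c * t) * F x y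

/-- The cone of all `y ∈ T_x M`, `y ≠ 0`, with `⟨y, V(x)⟩_y < -F(x, y)`. -/
def navCone (F : ∀ x : M, TangentSpace (𝓡 n) x → ℝ)
    (V : ∀ x : M, TangentSpace (𝓡 n) x) (x : M) : Set (TangentSpace (𝓡 n) x) :=
  {y | y ≠ 0 ∧ fundTensor (F x) y y (V x) < -F x y}

open scoped Classical in
/-- The Lorentz Finsler metric `F̃` induced by navigation with the datum `(F, V)`: for
`w = y + F(x, y) V(x)` with `y` in `navCone F V x`, the value `F̃(x, w)` is `F(x, y)`.
Tangent vectors `w` not of this form lie outside the domain of `F̃`; the value `0` there is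
a placeholder. When `F` is a Finsler metric and `F(-V) > 1`, the vector `y` is unique. -/
def navMetric (F : ∀ x : M, TangentSpace (𝓡 n) x → ℝ)
    (V : ∀ x : M, TangentSpace (𝓡 n) x) (x : M) (w : TangentSpace (𝓡 n) x) : ℝ :=
  if h : ∃ y ∈ navCone F V x, w = y + F x y • V x then F x h.choose else 0

/-- The expression of `F` in the local coordinates given by the chart `e`:
`(p, v) ↦ F(x, vⁱ ∂_{xⁱ})`, where `x` is the point with coordinates `p`. -/
def inChart (e : OpenPartialHomeomorph M (Coord n))
    (F : ∀ x : M, TangentSpace (𝓡 n) x → ℝ) (p v : Coord n) : ℝ :=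
  F (e.symm p) (mfderiv (𝓡 n) (𝓡 n) e.symm p v)

end Manifold

/-! ### Coordinate expressions, for a function `L = L(p, v)` of `p, v ∈ ℝⁿ` -/

section Coordinates

variable {n : ℕ}

/-- The matrix `g_{ij}(p, v) = (1/2) [L²]_{vⁱ vʲ}`. -/
def hessMatrix (L : Coord n → Coord n → ℝ) (p v : Coord n) : Matrix (Fin n) (Fin n) ℝ :=
  Matrix.of fun i j => fundTensor (L p) v (basisVec i) (basisVec j)

/-- `[L²]_{x^k}` at `(p, v)`. -/
def dx (L : Coord n → Coord n → ℝ) (k : Fin n) (p v : Coord n) : ℝ :=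
  lineDeriv ℝ (fun q => L q v ^ 2) p (basisVec k)

/-- `[L²]_{x^k y^l}` at `(p, v)`. -/
def dxdy (L : Coord n → Coord n → ℝ) (k l : Fin n) (p v : Coord n) : ℝ :=
  lineDeriv ℝ (fun w => dx L k p w) v (basisVec l)

/-- The spray coefficients `Gⁱ = (1/4) g^{il} ([L²]_{x^k y^l} y^k - [L²]_{x^l})`. -/
def sprayCoeff (L : Coord n → Coord n → ℝ) (p v : Coord n) : Coord n :=
  WithLp.toLp 2 fun i =>
    (1 / 4) * ∑ l, (hessMatrix L p v)⁻¹ i l * ((∑ k, dxdy L k l p v * v k) - dx L l p v)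

/-- The distortion `ln (√|det g_{ij}(p, v)| / σ(p))` of `L` for the measure `σ dx¹⋯dxⁿ`. -/
def distortion (L : Coord n → Coord n → ℝ) (σ : Coord n → ℝ) (p v : Coord n) : ℝ :=
  Real.log (Real.sqrt |(hessMatrix L p v).det| / σ p)

/-- The derivative of the distortion at `(p, v)` in the direction of the geodesic spray
`yⁱ ∂_{xⁱ} - 2 Gⁱ ∂_{yⁱ}`. -/
def coordSCurvature (L : Coord n → Coord n → ℝ) (σ : Coord n → ℝ) (p v : Coord n) : ℝ :=
  fderiv ℝ (fun q : Coord n × Coord n => distortion L σ q.1 q.2) (p, v)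
    (v, (-2 : ℝ) • sprayCoeff L p v)

end Coordinates

section Curvature

variable {n : ℕ} {M : Type*} [TopologicalSpace M] [ChartedSpace (Coord n) M]

/-- The density `σ` of the Busemann-Hausdorff measure `σ dx¹⋯dxⁿ` of `F` in the chart `e`:
the volume of the Euclidean unit ball of `ℝⁿ` divided by the volume of `{F(x, ·) ≤ 1}`. -/
def bhDensity (e : OpenPartialHomeomorph M (Coord n))
    (F : ∀ x : M, TangentSpace (𝓡 n) x → ℝ) (p : Coord n) : ℝ :=
  volume.real {v : Coord n | ‖v‖ ≤ 1} / volume.real {v : Coord n | inChart e F p v ≤ 1}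

/-- The S-curvature at `(x, y)` of the (conic pseudo-)Finsler metric `F` with respect to the
measure that has the density `σ` in the chart `e`, computed in that chart. -/
def sCurvature (e : OpenPartialHomeomorph M (Coord n))
    (F : ∀ x : M, TangentSpace (𝓡 n) x → ℝ) (σ : Coord n → ℝ)
    (x : M) (y : TangentSpace (𝓡 n) x) : ℝ :=
  coordSCurvature (inChart e F) σ (e x) (mfderiv (𝓡 n) (𝓡 n) e x y)

end Curvature

end FinslerNavigation

end

/-!
The S-curvature of the Lorentz Finsler metric induced by navigation with a homothetic field.

In a chart, let `L = L(p, v)` be the expression of `F`, let `θ = ∂_v L` be its vertical differential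
and let `V` be the expression of the vector field. The metric `L̃` of the navigation problem is
characterised by `L̃ ∘ Φ = L`, where `Φ(p, v) = (p, v + L(p, v) V(p))`. The vertical differential of
`Φ` has determinant `λ = 1 + θ(V)`, and the cone of admissible directions is `{λ < 0}`, so `Φ` is a
local diffeomorphism there and `L̃` is smooth. That `L̃` is well defined follows from the
fundamental inequality `θ(p, v) w ≤ L(p, w)` (`IsFinslerOn.navigation_unique`).

Differentiating `L̃ ∘ Φ = L` gives `θ̃ ∘ Φ = θ / λ`, hence the fundamental tensors satisfy
`det g̃ ∘ Φ = λ⁻⁽ⁿ⁺¹⁾ det g` (`det_hessMatrix_navMap`). The distortions for one and the same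
measure therefore satisfy `τ̃ ∘ Φ = τ - (n + 1)/2 · log |λ|`.

The infinitesimal homothety equation is `Vᶜ L = -2 c L`, where `Vᶜ = (V, DV v)` is the complete lift
of `V`. With `G` the geodesic spray of `L` and `C = (0, v)` the radial field, it implies that
`X = G + L (Vᶜ + 2 c C)` is the pull-back by `Φ` of the geodesic spray of `L̃`: the spray is
characterised by the Euler-Lagrange equation (`neg_two_smul_sprayCoeff_eq_iff`), and `X` satisfies
the pull-back of that equation. The same computation shows `X λ = -2 c L λ`.

The flow of `V` multiplies `L` by a constant, and so preserves the distortion of `L` for the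
Busemann-Hausdorff measure: the determinant of the differential of the flow enters `√(det g)` and
the density in the same way (`distortion_of_comp_linear`). Hence `Vᶜ τ = 0`. Also `C τ = 0` by
homogeneity. The S-curvature of `L̃` is thus `X (τ - (n + 1)/2 · log |λ|) = G τ + (n + 1) c L`
(`coordSCurvature_navMap`). The density is differentiable by the formula in polar coordinates for
the volume of the unit balls (`IsFinslerOn.differentiableAt_volume_ball`), so that the derivatives
of the distortions here are genuine.
-/

noncomputable section

namespace FinslerNavigation

open scoped Topology
open Filter

/-! ### Vertical derivatives and the Euler-Lagrange equation of the geodesic spray -/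

section VerticalDerivative

variable {E : Type*} [NormedAddCommGroup E] [NormedSpace ℝ E]

/-- The vertical differential `u ↦ ∂_v L(p, v) u` of `L = L(p, v)`, as a function of the point
`z = (p, v)` with values in covectors. -/
def vertDeriv (L : E → E → ℝ) (z : E × E) : E →L[ℝ] ℝ :=
  (fderiv ℝ (Function.uncurry L) z).comp (ContinuousLinearMap.inr ℝ E E)

lemma vertDeriv_apply (L : E → E → ℝ) (z : E × E) (u : E) :
    vertDeriv L z u = fderiv ℝ (Function.uncurry L) z (0, u) := rfl

lemma fderiv_uncurry_apply (L : E → E → ℝ) (z : E × E) (a b : E) :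
    fderiv ℝ (Function.uncurry L) z (a, b)
      = fderiv ℝ (Function.uncurry L) z (a, 0) + vertDeriv L z b := by
  rw [vertDeriv_apply, ← map_add]; simp

lemma contDiffAt_vertDeriv {L : E → E → ℝ} {z : E × E} {m k : ℕ∞ω}
    (hL : ContDiffAt ℝ k (Function.uncurry L) z) (hmk : m + 1 ≤ k) :
    ContDiffAt ℝ m (vertDeriv L) z :=
  (hL.fderiv_right hmk).clm_comp contDiffAt_const

lemma fderiv_vertDeriv_apply {L : E → E → ℝ} {z : E × E}
    (hL : ContDiffAt ℝ 2 (Function.uncurry L) z) (a : E × E) (u : E) :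
    fderiv ℝ (vertDeriv L) z a u
      = fderiv ℝ (fderiv ℝ (Function.uncurry L)) z a (0, u) := by
  have h1 : DifferentiableAt ℝ (fderiv ℝ (Function.uncurry L)) z :=
    (hL.fderiv_right (m := 1) (by norm_num)).differentiableAt (by norm_num)
  have h2 := h1.hasFDerivAt.clm_comp
    (hasFDerivAt_const (ContinuousLinearMap.inr ℝ E E) z)
  have h3 : fderiv ℝ (vertDeriv L) z = _ := h2.fderiv
  rw [h3]
  simp

/-- The second differential of `L` is symmetric. -/
lemma second_fderiv_symm {L : E → E → ℝ} {z : E × E}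
    (hL : ContDiffAt ℝ 2 (Function.uncurry L) z) (a b : E × E) :
    fderiv ℝ (fderiv ℝ (Function.uncurry L)) z a b
      = fderiv ℝ (fderiv ℝ (Function.uncurry L)) z b a :=
  (hL.isSymmSndFDerivAt (by simp)).eq a b

/-- Differentiating the function `z ↦ ∂_v L(z) (f z)`. -/
lemma hasFDerivAt_vertDeriv_apply {L : E → E → ℝ} {z : E × E}
    (hL : ContDiffAt ℝ 2 (Function.uncurry L) z) {f : E × E → E} {f' : E × E →L[ℝ] E}
    (hf : HasFDerivAt f f' z) :
    HasFDerivAt (fun q => vertDeriv L q (f q))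
      ((vertDeriv L z).comp f' + (fderiv ℝ (vertDeriv L) z).flip (f z)) z :=
  (((contDiffAt_vertDeriv (m := 1) hL (by norm_num)).differentiableAt
    (by norm_num)).hasFDerivAt).clm_apply hf

lemma eventually_line {P : E × E → Prop} {p v a : E} (h : ∀ᶠ z in 𝓝 (p, v), P z) :
    ∀ᶠ s : ℝ in 𝓝 0, P (p, v + s • a) := by
  have hc : ContinuousAt (fun s : ℝ => (p, v + s • a)) 0 := by fun_prop
  have h' : ∀ᶠ z in 𝓝 ((fun s : ℝ => (p, v + s • a)) 0), P z := by simpa using h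
  exact hc.eventually h'

lemma hasDerivAt_add_smul (v b : E) : HasDerivAt (fun t : ℝ => v + t • b) b 0 := by
  simpa using ((hasDerivAt_id (0 : ℝ)).smul_const b).const_add v

lemma hasDerivAt_comp_vertical_line {G : Type*} [NormedAddCommGroup G] [NormedSpace ℝ G]
    {f : E × E → G} {f' : E × E →L[ℝ] G} {p v : E} (hf : HasFDerivAt f f' (p, v)) (b : E) :
    HasDerivAt (fun t : ℝ => f (p, v + t • b)) (f' (0, b)) 0 := by
  have h1 := (hasDerivAt_const (0 : ℝ) p).prodMk (hasDerivAt_add_smul v b)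
  have hz : (p, v + (0 : ℝ) • b) = (p, v) := by simp
  rw [← hz] at hf
  exact hf.comp_hasDerivAt (0 : ℝ) h1

lemma hasDerivAt_vertical_line {L : E → E → ℝ} {p v : E}
    (hL : DifferentiableAt ℝ (Function.uncurry L) (p, v)) (b : E) :
    HasDerivAt (fun t : ℝ => L p (v + t • b)) (vertDeriv L (p, v) b) 0 :=
  hasDerivAt_comp_vertical_line hL.hasFDerivAt b

/-- The fundamental tensor is `L ∂_v² L + ∂_v L ⊗ ∂_v L`. -/
lemma fundTensor_eq {L : E → E → ℝ} {p v : E}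
    (hL : ContDiffAt ℝ 2 (Function.uncurry L) (p, v)) (a b : E) :
    fundTensor (L p) v a b = L p v * fderiv ℝ (vertDeriv L) (p, v) (0, a) b
      + vertDeriv L (p, v) a * vertDeriv L (p, v) b := by
  have hev : ∀ᶠ s : ℝ in 𝓝 0,
      deriv (fun t : ℝ => L p (v + s • a + t • b) ^ 2) 0
        = 2 * L p (v + s • a) * vertDeriv L (p, v + s • a) b := by
    filter_upwards [eventually_line (a := a) (hL.eventually (by norm_num))] with s hs
    have h := (hasDerivAt_vertical_line (hs.differentiableAt (by norm_num)) b).fun_pow 2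
    rw [h.deriv]
    simp
  have h1 := hasDerivAt_vertical_line (hL.differentiableAt (by norm_num)) a
  have h2 : HasDerivAt (fun s : ℝ => vertDeriv L (p, v + s • a) b)
      (fderiv ℝ (vertDeriv L) (p, v) (0, a) b) 0 := by
    simpa using hasDerivAt_comp_vertical_line
      (hasFDerivAt_vertDeriv_apply hL (hasFDerivAt_const b (p, v))) a
  have h3 := ((h1.const_mul 2).fun_mul h2)
  unfold fundTensor
  rw [EventuallyEq.deriv_eq hev, h3.deriv]
  simp
  ring

end VerticalDerivative

section Spray

variable {n : ℕ} {L : Coord n → Coord n → ℝ} {p v : Coord n}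

lemma hasDerivAt_horizontal_line (hL : DifferentiableAt ℝ (Function.uncurry L) (p, v))
    (a : Coord n) :
    HasDerivAt (fun t : ℝ => L (p + t • a) v) (fderiv ℝ (Function.uncurry L) (p, v) (a, 0)) 0 := by
  have h1 := (hasDerivAt_add_smul p a).prodMk (hasDerivAt_const (0 : ℝ) v)
  have h2 : HasFDerivAt (Function.uncurry L) (fderiv ℝ (Function.uncurry L) (p, v))
      (p + (0 : ℝ) • a, v) := by simpa using hL.hasFDerivAt
  exact h2.comp_hasDerivAt (0 : ℝ) h1

lemma dx_eq (hL : DifferentiableAt ℝ (Function.uncurry L) (p, v)) (k : Fin n) :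
    dx L k p v = 2 * L p v * fderiv ℝ (Function.uncurry L) (p, v) (basisVec k, 0) := by
  have h := (hasDerivAt_horizontal_line hL (basisVec k)).fun_pow 2
  unfold dx lineDeriv
  rw [h.deriv]
  simp

lemma dxdy_eq (hL : ContDiffAt ℝ 2 (Function.uncurry L) (p, v)) (k l : Fin n) :
    dxdy L k l p v =
      2 * (vertDeriv L (p, v) (basisVec l) * fderiv ℝ (Function.uncurry L) (p, v) (basisVec k, 0)
        + L p v * fderiv ℝ (vertDeriv L) (p, v) (basisVec k, 0) (basisVec l)) := by
  have hev : ∀ᶠ s : ℝ in 𝓝 0,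
      dx L k p (v + s • basisVec l) = 2 * L p (v + s • basisVec l)
        * fderiv ℝ (Function.uncurry L) (p, v + s • basisVec l) (basisVec k, 0) := by
    filter_upwards [eventually_line (a := basisVec l) (hL.eventually (by norm_num))] with s hs
    exact dx_eq (hs.differentiableAt (by norm_num)) k
  have h1 := hasDerivAt_vertical_line (hL.differentiableAt (by norm_num)) (basisVec l)
  have h2 : HasDerivAt
      (fun s : ℝ => fderiv ℝ (Function.uncurry L) (p, v + s • basisVec l) (basisVec k, 0))
      (fderiv ℝ (vertDeriv L) (p, v) (basisVec k, 0) (basisVec l)) 0 := by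
    have h0 : DifferentiableAt ℝ (fderiv ℝ (Function.uncurry L)) (p, v) :=
      (hL.fderiv_right (m := 1) (by norm_num)).differentiableAt (by norm_num)
    rw [fderiv_vertDeriv_apply hL, second_fderiv_symm hL]
    simpa using hasDerivAt_comp_vertical_line
      (h0.hasFDerivAt.clm_apply (hasFDerivAt_const (basisVec k, (0 : Coord n)) (p, v)))
      (basisVec l)
  have h3 := ((h1.const_mul 2).fun_mul h2)
  unfold dxdy lineDeriv
  rw [EventuallyEq.deriv_eq hev, h3.deriv]
  simp
  ring

lemma sum_smul_basisVec (u : Coord n) : ∑ i, u i • (basisVec i : Coord n) = u := by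
  have := (EuclideanSpace.basisFun (Fin n) ℝ).sum_repr u
  simpa [basisVec] using this

lemma linearMap_apply_eq_sum {G : Type*} [AddCommGroup G] [Module ℝ G]
    (f : Coord n →ₗ[ℝ] G) (u : Coord n) :
    f u = ∑ i, u i • f (basisVec i) := by
  conv_lhs => rw [← sum_smul_basisVec u]
  simp

lemma hessMatrix_apply (hL : ContDiffAt ℝ 2 (Function.uncurry L) (p, v)) (i j : Fin n) :
    hessMatrix L p v i j = L p v * fderiv ℝ (vertDeriv L) (p, v) (0, basisVec i) (basisVec j)
      + vertDeriv L (p, v) (basisVec i) * vertDeriv L (p, v) (basisVec j) := by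
  rw [hessMatrix, Matrix.of_apply, fundTensor_eq hL]

/-- The vertical Hessian is symmetric. -/
lemma fderiv_vertDeriv_symm (hL : ContDiffAt ℝ 2 (Function.uncurry L) (p, v)) (a b : Coord n) :
    fderiv ℝ (vertDeriv L) (p, v) (0, a) b = fderiv ℝ (vertDeriv L) (p, v) (0, b) a := by
  rw [fderiv_vertDeriv_apply hL, fderiv_vertDeriv_apply hL, second_fderiv_symm hL]

/-- Differentiating Euler's identity `∂_v L(p, v) v = L(p, v)`. -/
lemma fderiv_vertDeriv_apply_self (hL : ContDiffAt ℝ 2 (Function.uncurry L) (p, v))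
    (heuler : ∀ᶠ q in 𝓝 (p, v), vertDeriv L q q.2 = Function.uncurry L q) (a b : Coord n) :
    fderiv ℝ (vertDeriv L) (p, v) (a, b) v = fderiv ℝ (Function.uncurry L) (p, v) (a, 0) := by
  have h1 := hasFDerivAt_vertDeriv_apply hL (hasFDerivAt_snd (𝕜 := ℝ) (p := (p, v)))
  have h2 := h1.unique
    ((hL.differentiableAt (by norm_num)).hasFDerivAt.congr_of_eventuallyEq heuler)
  have h3 := congrArg (fun f => f (a, b)) h2
  simp only [add_apply, ContinuousLinearMap.comp_apply, ContinuousLinearMap.coe_snd',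
    ContinuousLinearMap.flip_apply] at h3
  rw [fderiv_uncurry_apply] at h3
  linarith

/-- The vertical Hessian annihilates the position vector. -/
lemma fderiv_vertDeriv_self (hL : ContDiffAt ℝ 2 (Function.uncurry L) (p, v))
    (heuler : ∀ᶠ q in 𝓝 (p, v), vertDeriv L q q.2 = Function.uncurry L q) (u : Coord n) :
    fderiv ℝ (vertDeriv L) (p, v) (0, v) u = 0 := by
  rw [fderiv_vertDeriv_symm hL, fderiv_vertDeriv_apply_self hL heuler, Prod.mk_zero_zero, map_zero]

/-- The spray coefficients are characterised by the Euler-Lagrange equation of `L²`: writing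
`b = -2 G`, the vector `(v, b)` is the geodesic spray at `(p, v)`. -/
lemma neg_two_smul_sprayCoeff_eq_iff (hL : ContDiffAt ℝ 2 (Function.uncurry L) (p, v))
    (hdet : (hessMatrix L p v).det ≠ 0) (b : Coord n) :
    (-2 : ℝ) • sprayCoeff L p v = b ↔
      ∀ u : Coord n, L p v * fderiv ℝ (vertDeriv L) (p, v) (v, b) u
        + fderiv ℝ (Function.uncurry L) (p, v) (v, b) * vertDeriv L (p, v) u
          = L p v * fderiv ℝ (Function.uncurry L) (p, v) (u, 0) := by
  set H := hessMatrix L p v with hH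
  set D := fderiv ℝ (Function.uncurry L) (p, v) with hD
  set S := fderiv ℝ (vertDeriv L) (p, v) with hS
  set θ := vertDeriv L (p, v) with hθ
  have hunit : IsUnit H.det := isUnit_iff_ne_zero.mpr hdet
  set r : Fin n → ℝ := fun l => (∑ k, dxdy L k l p v * v k) - dx L l p v with hr
  have hG : ∀ i, sprayCoeff L p v i = (1 / 4) * (H⁻¹.mulVec r) i := fun i => rfl
  have hrl : ∀ l, r l = 2 * (θ (basisVec l) * D (v, 0) + L p v * S (v, 0) (basisVec l)
      - L p v * D (basisVec l, 0)) := by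
    intro l
    have h1 : D (v, 0) = ∑ k, v k * D (basisVec k, 0) := by
      simpa using linearMap_apply_eq_sum ((D.comp (ContinuousLinearMap.inl ℝ _ _)).toLinearMap) v
    have h2 : S (v, 0) (basisVec l) = ∑ k, v k * S (basisVec k, 0) (basisVec l) := by
      simpa using linearMap_apply_eq_sum
        (((S.flip (basisVec l)).comp (ContinuousLinearMap.inl ℝ _ _)).toLinearMap) v
    simp only [hr]
    rw [dx_eq (hL.differentiableAt (by norm_num)), h1, h2, Finset.sum_congr rfl
      (fun k _ => by rw [dxdy_eq hL])]
    simp only [Finset.mul_sum, mul_add, mul_sub, ← Finset.sum_add_distrib]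
    rw [← hD, ← hS, ← hθ]
    congr 1
    · exact Finset.sum_congr rfl (fun k _ => by ring)
    · ring
  have hHb : ∀ l, (H.mulVec b) l = L p v * S (0, b) (basisVec l) + θ b * θ (basisVec l) := by
    intro l
    have h1 : θ b = ∑ k, b k * θ (basisVec k) := by
      simpa using linearMap_apply_eq_sum θ.toLinearMap b
    have h2 : S (0, b) (basisVec l) = ∑ k, b k * S (0, basisVec k) (basisVec l) := by
      simpa using linearMap_apply_eq_sum
        (((S.flip (basisVec l)).comp (ContinuousLinearMap.inr ℝ _ _)).toLinearMap) b
    rw [h1, h2, Matrix.mulVec, dotProduct, Finset.mul_sum, Finset.sum_mul,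
      ← Finset.sum_add_distrib]
    refine Finset.sum_congr rfl (fun k _ => ?_)
    rw [hH, hessMatrix_apply hL, ← hS, ← hθ, fderiv_vertDeriv_symm hL, ← hS]
    ring
  have hstep : (-2 : ℝ) • sprayCoeff L p v = b ↔ H.mulVec b = (-(1 / 2 : ℝ)) • r := by
    constructor
    · intro h
      have : (b : Fin n → ℝ) = (-(1 / 2 : ℝ)) • H⁻¹.mulVec r := by
        funext i
        rw [← h]
        simp only [PiLp.smul_apply, smul_eq_mul, hG, Pi.smul_apply]
        ring
      rw [this, Matrix.mulVec_smul, Matrix.mulVec_mulVec, Matrix.mul_nonsing_inv _ hunit,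
        Matrix.one_mulVec]
    · intro h
      have h' := congrArg (fun w => H⁻¹.mulVec w) h
      simp only [Matrix.mulVec_mulVec, Matrix.nonsing_inv_mul _ hunit, Matrix.one_mulVec,
        Matrix.mulVec_smul] at h'
      ext i
      rw [congrFun h' i]
      simp only [PiLp.smul_apply, smul_eq_mul, hG, Pi.smul_apply]
      ring
  have hsplitS : ∀ u, S (v, b) u = S (v, 0) u + S (0, b) u := by
    intro u
    rw [← add_apply, ← map_add]; simp
  have hsplitD : D (v, b) = D (v, 0) + θ b := fderiv_uncurry_apply L (p, v) v b
  rw [hstep]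
  constructor
  · intro h
    have hbasis : ∀ l, L p v * S (v, b) (basisVec l) + D (v, b) * θ (basisVec l)
        = L p v * D (basisVec l, 0) := by
      intro l
      have := congrFun h l
      rw [hHb, Pi.smul_apply, smul_eq_mul, hrl] at this
      rw [hsplitS, hsplitD]
      linarith
    intro u
    have h1 : S (v, b) u = ∑ k, u k * S (v, b) (basisVec k) := by
      simpa using linearMap_apply_eq_sum (S (v, b)).toLinearMap u
    have h2 : θ u = ∑ k, u k * θ (basisVec k) := by
      simpa using linearMap_apply_eq_sum θ.toLinearMap u
    have h3 : D (u, 0) = ∑ k, u k * D (basisVec k, 0) := by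
      simpa using linearMap_apply_eq_sum ((D.comp (ContinuousLinearMap.inl ℝ _ _)).toLinearMap) u
    rw [h1, h2, h3, Finset.mul_sum, Finset.mul_sum, Finset.mul_sum, ← Finset.sum_add_distrib]
    refine Finset.sum_congr rfl (fun k _ => ?_)
    linear_combination (u k) * hbasis k
  · intro h
    funext l
    have := h (basisVec l)
    rw [hsplitS, hsplitD] at this
    rw [hHb, Pi.smul_apply, smul_eq_mul, hrl]
    linarith

end Spray

/-! ### The determinant of the fundamental tensor and the distortion -/

section Determinant

variable {n : ℕ} {L : Coord n → Coord n → ℝ} {p v : Coord n}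

/-- The standard basis of `ℝⁿ`. -/
def stdBasis (n : ℕ) : Module.Basis (Fin n) ℝ (Coord n) :=
  (EuclideanSpace.basisFun (Fin n) ℝ).toBasis

lemma stdBasis_apply (i : Fin n) : stdBasis n i = basisVec i := by
  simp [stdBasis, basisVec]

/-- The Gram determinant of a bilinear form on `ℝⁿ`. -/
def gramDet (B : Coord n →ₗ[ℝ] Coord n →ₗ[ℝ] ℝ) : ℝ :=
  (LinearMap.toMatrix₂ (stdBasis n) (stdBasis n) B).det

lemma gramDet_compl₁₂ (B : Coord n →ₗ[ℝ] Coord n →ₗ[ℝ] ℝ) (A A' : Coord n →ₗ[ℝ] Coord n) :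
    gramDet (B.compl₁₂ A A') = LinearMap.det A * gramDet B * LinearMap.det A' := by
  rw [gramDet, LinearMap.toMatrix₂_compl₁₂ (stdBasis n) (stdBasis n), Matrix.det_mul,
    Matrix.det_mul, Matrix.det_transpose, LinearMap.det_toMatrix, LinearMap.det_toMatrix, gramDet]

lemma gramDet_smul (r : ℝ) (B : Coord n →ₗ[ℝ] Coord n →ₗ[ℝ] ℝ) :
    gramDet (r • B) = r ^ n * gramDet B := by
  simp [gramDet]

/-- The fundamental tensor `L ∂_v² L + ∂_v L ⊗ ∂_v L` as a bilinear form. -/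
def hessForm (L : Coord n → Coord n → ℝ) (p v : Coord n) : Coord n →ₗ[ℝ] Coord n →ₗ[ℝ] ℝ :=
  LinearMap.mk₂ ℝ (fun a b => L p v * fderiv ℝ (vertDeriv L) (p, v) (0, a) b
      + vertDeriv L (p, v) a * vertDeriv L (p, v) b)
    (fun a a' b => by
      have : ((0 : Coord n), a + a') = (0, a) + (0, a') := by simp
      rw [this, map_add, map_add, add_apply]; ring)
    (fun r a b => by
      have : ((0 : Coord n), r • a) = r • (0, a) := by simp
      rw [this, map_smul, map_smul, smul_apply, smul_eq_mul, smul_eq_mul,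
        smul_eq_mul]; ring)
    (fun a b b' => by rw [map_add, map_add]; ring)
    (fun r a b => by rw [map_smul, map_smul, smul_eq_mul, smul_eq_mul, smul_eq_mul]; ring)

lemma hessForm_apply (a b : Coord n) :
    hessForm L p v a b = L p v * fderiv ℝ (vertDeriv L) (p, v) (0, a) b
      + vertDeriv L (p, v) a * vertDeriv L (p, v) b := rfl

lemma fundTensor_eq_hessForm (hL : ContDiffAt ℝ 2 (Function.uncurry L) (p, v)) (a b : Coord n) :
    fundTensor (L p) v a b = hessForm L p v a b := fundTensor_eq hL a b

lemma det_hessMatrix (hL : ContDiffAt ℝ 2 (Function.uncurry L) (p, v)) :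
    (hessMatrix L p v).det = gramDet (hessForm L p v) := by
  rw [gramDet]
  congr 1
  ext i j
  rw [LinearMap.toMatrix₂_apply, stdBasis_apply, stdBasis_apply, hessMatrix_apply hL,
    hessForm_apply]

/-- A positive definite fundamental tensor has nonzero determinant. -/
lemma det_hessMatrix_ne_zero (hL : ContDiffAt ℝ 2 (Function.uncurry L) (p, v))
    (hpos : ∀ u, u ≠ 0 → 0 < fundTensor (L p) v u u) : (hessMatrix L p v).det ≠ 0 := by
  rw [det_hessMatrix hL, gramDet]
  intro h0
  obtain ⟨w, hw, hw0⟩ := Matrix.exists_mulVec_eq_zero_iff.mpr h0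
  set u : Coord n := WithLp.toLp 2 w with hu
  have hune : u ≠ 0 := by
    intro h
    apply hw
    funext i
    have := congrArg (fun q : Coord n => q i) h
    simpa [hu] using this
  have h1 : ∀ i, hessForm L p v (basisVec i) u = 0 := by
    intro i
    have := congrFun hw0 i
    rw [Matrix.mulVec, dotProduct] at this
    rw [linearMap_apply_eq_sum (hessForm L p v (basisVec i)) u, ← this.trans (Pi.zero_apply i)]
    refine Finset.sum_congr rfl (fun k _ => ?_)
    rw [LinearMap.toMatrix₂_apply, stdBasis_apply, stdBasis_apply, smul_eq_mul, mul_comm]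
  have h2 : hessForm L p v u u = 0 := by
    have := linearMap_apply_eq_sum ((hessForm L p v).flip u) u
    simp only [LinearMap.flip_apply, h1, smul_zero, Finset.sum_const_zero] at this
    exact this
  have := hpos u hune
  rw [fundTensor_eq_hessForm hL, h2] at this
  exact lt_irrefl _ this

end Determinant

section Invariance

variable {n : ℕ}

lemma fundTensor_comp_linear {W W' : Type*} [AddCommGroup W] [Module ℝ W] [AddCommGroup W']
    [Module ℝ W'] {N : W → ℝ} {N' : W' → ℝ} (A : W →ₗ[ℝ] W') {k : ℝ}
    (h : ∀ w, N' (A w) = k * N w) (y u v : W) :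
    fundTensor N' (A y) (A u) (A v) = k ^ 2 * fundTensor N y u v := by
  have h1 : ∀ s t : ℝ, N' (A y + s • A u + t • A v) ^ 2 = k ^ 2 * N (y + s • u + t • v) ^ 2 := by
    intro s t
    rw [← map_smul, ← map_smul, ← map_add, ← map_add, h]; ring
  unfold fundTensor
  simp only [h1, deriv_const_mul_field]
  ring

variable {L : Coord n → Coord n → ℝ} {σ : Coord n → ℝ}

/-- How the determinant of the fundamental tensor changes under a linear map which multiplies
`L` by a constant. -/
lemma det_hessMatrix_of_comp_linear {p v q : Coord n} (A : Coord n →ₗ[ℝ] Coord n) {k : ℝ}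
    (hL : ContDiffAt ℝ 2 (Function.uncurry L) (p, v))
    (hL' : ContDiffAt ℝ 2 (Function.uncurry L) (q, A v))
    (h : ∀ w, L q (A w) = k * L p w) :
    LinearMap.det A ^ 2 * (hessMatrix L q (A v)).det = (k ^ 2) ^ n * (hessMatrix L p v).det := by
  have hB : (hessForm L q (A v)).compl₁₂ A A = k ^ 2 • hessForm L p v := by
    refine LinearMap.ext₂ (fun a b => ?_)
    rw [LinearMap.compl₁₂_apply, LinearMap.smul_apply, LinearMap.smul_apply,
      ← fundTensor_eq_hessForm hL', ← fundTensor_eq_hessForm hL, smul_eq_mul,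
      fundTensor_comp_linear A h]
  have := congrArg gramDet hB
  rw [gramDet_compl₁₂, gramDet_smul, ← det_hessMatrix hL, ← det_hessMatrix hL'] at this
  linear_combination this

/-- The distortion is invariant under a linear map which multiplies `L` by a constant and under
which the density of the measure changes accordingly. -/
lemma distortion_of_comp_linear {p v q : Coord n} (A : Coord n →ₗ[ℝ] Coord n) {k : ℝ}
    (hk : 0 < k) (hA : LinearMap.det A ≠ 0)
    (hL : ContDiffAt ℝ 2 (Function.uncurry L) (p, v))
    (hL' : ContDiffAt ℝ 2 (Function.uncurry L) (q, A v))
    (h : ∀ w, L q (A w) = k * L p w) (hσ : |LinearMap.det A| * σ q = k ^ n * σ p) :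
    distortion L σ q (A v) = distortion L σ p v := by
  have hd := det_hessMatrix_of_comp_linear A hL hL' h
  have hA' : 0 < |LinearMap.det A| := abs_pos.mpr hA
  have hkn : 0 < k ^ n := pow_pos hk n
  have h1 : |LinearMap.det A| * √|(hessMatrix L q (A v)).det|
      = k ^ n * √|(hessMatrix L p v).det| := by
    have := congrArg (fun r => √|r|) hd
    simp only [abs_mul] at this
    rw [Real.sqrt_mul (abs_nonneg _), Real.sqrt_mul (abs_nonneg _),
      abs_of_nonneg (sq_nonneg (LinearMap.det A)),
      Real.sqrt_sq_eq_abs, ← pow_mul, mul_comm 2 n, pow_mul, abs_of_nonneg (sq_nonneg (k ^ n)),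
      Real.sqrt_sq hkn.le] at this
    exact this
  unfold distortion
  congr 1
  rw [← mul_div_mul_left _ _ hA'.ne', h1, hσ, mul_div_mul_left _ _ hkn.ne']

/-- The distortion is positively homogeneous of degree `0` in the direction. -/
lemma distortion_smul {p v : Coord n} {r : ℝ} (hr : 0 < r)
    (hL : ContDiffAt ℝ 2 (Function.uncurry L) (p, v))
    (hL' : ContDiffAt ℝ 2 (Function.uncurry L) (p, r • v))
    (h : ∀ w, L p (r • w) = r * L p w) :
    distortion L σ p (r • v) = distortion L σ p v := by
  have hdet : LinearMap.det (r • (LinearMap.id : Coord n →ₗ[ℝ] Coord n)) = r ^ n := by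
    simp [LinearMap.det_smul]
  exact distortion_of_comp_linear (r • (LinearMap.id : Coord n →ₗ[ℝ] Coord n)) hr
    (by rw [hdet]; exact (pow_pos hr n).ne') hL hL' h
    (by rw [hdet, abs_of_pos (pow_pos hr n)])

end Invariance

section Differentiability

variable {n : ℕ} {L : Coord n → Coord n → ℝ} {σ : Coord n → ℝ} {p v : Coord n}

lemma contDiffAt_det_hessMatrix (hL : ContDiffAt ℝ 3 (Function.uncurry L) (p, v)) :
    ContDiffAt ℝ 1 (fun q : Coord n × Coord n => (hessMatrix L q.1 q.2).det) (p, v) := by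
  have hentry : ∀ i j, ContDiffAt ℝ 1
      (fun q : Coord n × Coord n => hessMatrix L q.1 q.2 i j) (p, v) := by
    intro i j
    have hev : (fun q : Coord n × Coord n => hessMatrix L q.1 q.2 i j) =ᶠ[𝓝 (p, v)]
        fun q => Function.uncurry L q * fderiv ℝ (vertDeriv L) q (0, basisVec i) (basisVec j)
          + vertDeriv L q (basisVec i) * vertDeriv L q (basisVec j) := by
      filter_upwards [hL.eventually (by norm_num)] with q hq
      exact hessMatrix_apply (hq.of_le (by norm_num)) i j
    refine ContDiffAt.congr_of_eventuallyEq ?_ hev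
    have h1 : ContDiffAt ℝ 2 (vertDeriv L) (p, v) := contDiffAt_vertDeriv hL (by norm_num)
    have h2 : ContDiffAt ℝ 1 (fderiv ℝ (vertDeriv L)) (p, v) := h1.fderiv_right (by norm_num)
    have h3 : ∀ k : Fin n, ContDiffAt ℝ 1 (fun q => vertDeriv L q (basisVec k)) (p, v) :=
      fun k => (h1.of_le (by norm_num)).clm_apply contDiffAt_const
    exact ((hL.of_le (by norm_num)).mul ((h2.clm_apply contDiffAt_const).clm_apply
      contDiffAt_const)).add ((h3 i).mul (h3 j))
  simp only [Matrix.det_apply]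
  refine ContDiffAt.sum (fun τ _ => ContDiffAt.const_smul _ ?_)
  exact contDiffAt_prod (fun i _ => hentry _ _)

lemma differentiableAt_distortion (hL : ContDiffAt ℝ 3 (Function.uncurry L) (p, v))
    (hdet : (hessMatrix L p v).det ≠ 0) (hσ : DifferentiableAt ℝ σ p) (hσ0 : σ p ≠ 0) :
    DifferentiableAt ℝ (fun q : Coord n × Coord n => distortion L σ q.1 q.2) (p, v) := by
  have h1 : DifferentiableAt ℝ (fun q : Coord n × Coord n => (hessMatrix L q.1 q.2).det) (p, v) :=
    (contDiffAt_det_hessMatrix hL).differentiableAt (by norm_num)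
  have h2 : DifferentiableAt ℝ
      (fun q : Coord n × Coord n => |(hessMatrix L q.1 q.2).det|) (p, v) := h1.abs hdet
  have h3 : DifferentiableAt ℝ (fun q : Coord n × Coord n => (σ q.1)⁻¹) (p, v) :=
    (DifferentiableAt.comp (p, v) hσ differentiableAt_fst).fun_inv hσ0
  have h4 := (h2.sqrt (abs_pos.mpr hdet).ne').fun_mul h3
  simp only [← div_eq_mul_inv] at h4
  exact h4.log (div_ne_zero (Real.sqrt_ne_zero'.mpr (abs_pos.mpr hdet)) hσ0)

lemma distortion_eq (hdet : (hessMatrix L p v).det ≠ 0) (hσ0 : σ p ≠ 0) :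
    distortion L σ p v = Real.log (hessMatrix L p v).det / 2 - Real.log (σ p) := by
  rw [distortion, Real.log_div (Real.sqrt_ne_zero'.mpr (abs_pos.mpr hdet)) hσ0,
    Real.log_sqrt (abs_nonneg _), Real.log_abs]

end Differentiability

/-! ### The navigation map in coordinates -/

section NavigationMap

variable {E : Type*} [NormedAddCommGroup E] [NormedSpace ℝ E]

/-- The navigation map `(p, v) ↦ (p, v + L(p, v) V(p))`. -/
def navMap (L : E → E → ℝ) (V : E → E) (z : E × E) : E × E :=
  (z.1, z.2 + Function.uncurry L z • V z.1)

/-- The function `λ = 1 + ∂_v L (V)`, which is the determinant of the vertical differential of the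
navigation map. -/
def navFactor (L : E → E → ℝ) (V : E → E) (z : E × E) : ℝ := 1 + vertDeriv L z (V z.1)

/-- The differential of the navigation map. -/
def navMapDeriv (L : E → E → ℝ) (V : E → E) (z : E × E) : E × E →L[ℝ] E × E :=
  (ContinuousLinearMap.fst ℝ E E).prod
    (ContinuousLinearMap.snd ℝ E E
      + (Function.uncurry L z • (fderiv ℝ V z.1).comp (ContinuousLinearMap.fst ℝ E E)
        + (fderiv ℝ (Function.uncurry L) z).smulRight (V z.1)))

variable {L Lt : E → E → ℝ} {V : E → E} {z : E × E}

lemma navMapDeriv_apply (a b : E) :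
    navMapDeriv L V z (a, b) = (a, b + (Function.uncurry L z • fderiv ℝ V z.1 a
      + fderiv ℝ (Function.uncurry L) z (a, b) • V z.1)) := rfl

lemma hasFDerivAt_navMap (hL : DifferentiableAt ℝ (Function.uncurry L) z)
    (hV : DifferentiableAt ℝ V z.1) : HasFDerivAt (navMap L V) (navMapDeriv L V z) z := by
  have h1 : HasFDerivAt (fun q : E × E => V q.1)
      ((fderiv ℝ V z.1).comp (ContinuousLinearMap.fst ℝ E E)) z :=
    hV.hasFDerivAt.comp z hasFDerivAt_fst
  exact hasFDerivAt_fst.prodMk (hasFDerivAt_snd.add (hL.hasFDerivAt.smul h1))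

lemma contDiffAt_navMap {k : ℕ∞ω} (hL : ContDiffAt ℝ k (Function.uncurry L) z)
    (hV : ContDiffAt ℝ k V z.1) : ContDiffAt ℝ k (navMap L V) z :=
  contDiffAt_fst.prodMk (contDiffAt_snd.add (hL.smul (hV.comp z contDiffAt_fst)))

lemma navMapDeriv_injective (hlam : navFactor L V z ≠ 0) :
    Function.Injective (navMapDeriv L V z) := by
  rw [injective_iff_map_eq_zero]
  rintro ⟨a, b⟩ h
  rw [navMapDeriv_apply, Prod.mk_eq_zero] at h
  obtain ⟨rfl, h⟩ := h
  rw [map_zero, smul_zero, zero_add, ← vertDeriv_apply] at h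
  have h1 := congrArg (vertDeriv L z) h
  rw [map_add, map_smul, map_zero, smul_eq_mul] at h1
  have h2 : vertDeriv L z b * navFactor L V z = 0 := by rw [navFactor]; linear_combination h1
  have h3 : vertDeriv L z b = 0 := (mul_eq_zero.mp h2).resolve_right hlam
  rw [h3, zero_smul, add_zero] at h
  rw [h]; rfl

/-- A function `Lt` with `Lt ∘ Φ = L`, where `Φ` is the navigation map, is as smooth as `L`: by the
inverse function theorem `Φ` is a local diffeomorphism where `λ ≠ 0`. -/
lemma contDiffAt_of_navMap [FiniteDimensional ℝ E] [CompleteSpace E] {k : ℕ∞ω} (hk : k ≠ 0)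
    (hL : ContDiffAt ℝ k (Function.uncurry L) z) (hV : ContDiffAt ℝ k V z.1)
    (hlam : navFactor L V z ≠ 0)
    (hLt : ∀ᶠ q in 𝓝 z, Function.uncurry Lt (navMap L V q) = Function.uncurry L q) :
    ContDiffAt ℝ k (Function.uncurry Lt) (navMap L V z) := by
  have hΦ := contDiffAt_navMap hL hV
  set A : (E × E) ≃L[ℝ] (E × E) := (LinearEquiv.ofInjectiveEndo (navMapDeriv L V z).toLinearMap
    (navMapDeriv_injective hlam)).toContinuousLinearEquiv with hA
  have hAeq : (A : E × E →L[ℝ] E × E) = navMapDeriv L V z := by ext w <;> rfl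
  have hd : HasFDerivAt (navMap L V) (A : E × E →L[ℝ] E × E) z := by
    rw [hAeq]
    exact hasFDerivAt_navMap (hL.differentiableAt hk) (hV.differentiableAt hk)
  have hinv := hΦ.to_localInverse hd hk
  have hz : hΦ.localInverse hd hk (navMap L V z) = z := hΦ.localInverse_apply_image hd hk
  have hright : ∀ᶠ q in 𝓝 (navMap L V z), navMap L V (hΦ.localInverse hd hk q) = q :=
    (hΦ.hasStrictFDerivAt' hd hk).eventually_right_inverse
  have hcont : Tendsto (hΦ.localInverse hd hk) (𝓝 (navMap L V z)) (𝓝 z) := by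
    have := hinv.continuousAt
    rw [ContinuousAt, hz] at this
    exact this
  have hev : Function.uncurry Lt =ᶠ[𝓝 (navMap L V z)]
      fun q => Function.uncurry L (hΦ.localInverse hd hk q) := by
    filter_upwards [hright, hcont.eventually hLt] with q hq hq'
    rw [hq] at hq'
    exact hq'
  refine ContDiffAt.congr_of_eventuallyEq ?_ hev
  have hL' : ContDiffAt ℝ k (Function.uncurry L) (hΦ.localInverse hd hk (navMap L V z)) := by
    rw [hz]; exact hL
  exact hL'.comp _ hinv

/-- First derivatives of `Lt`, where `Lt ∘ Φ = L`: the vertical differential is divided by `λ`. -/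
lemma navMap_first_derivatives (hL : DifferentiableAt ℝ (Function.uncurry L) z)
    (hV : DifferentiableAt ℝ V z.1)
    (hLt' : DifferentiableAt ℝ (Function.uncurry Lt) (navMap L V z))
    (hlam : navFactor L V z ≠ 0)
    (hLt : ∀ᶠ q in 𝓝 z, Function.uncurry Lt (navMap L V q) = Function.uncurry L q) :
    (∀ u, vertDeriv Lt (navMap L V z) u = vertDeriv L z u / navFactor L V z) ∧
    ∀ a, fderiv ℝ (Function.uncurry Lt) (navMap L V z) (a, 0)
      = (fderiv ℝ (Function.uncurry L) z (a, 0)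
        - Function.uncurry L z * vertDeriv L z (fderiv ℝ V z.1 a)) / navFactor L V z := by
  have h1 := (hLt'.hasFDerivAt.comp z (hasFDerivAt_navMap hL hV)).congr_of_eventuallyEq
    (EventuallyEq.symm hLt)
  have h2 : ∀ a b, fderiv ℝ (Function.uncurry Lt) (navMap L V z) (a, b +
      (Function.uncurry L z • fderiv ℝ V z.1 a + fderiv ℝ (Function.uncurry L) z (a, b) • V z.1))
      = fderiv ℝ (Function.uncurry L) z (a, b) := by
    intro a b
    exact congrArg (fun f => f (a, b)) (h1.unique hL.hasFDerivAt)
  have hvert : ∀ u, vertDeriv Lt (navMap L V z) u + vertDeriv L z u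
      * vertDeriv Lt (navMap L V z) (V z.1) = vertDeriv L z u := by
    intro u
    have := h2 0 u
    rwa [map_zero, smul_zero, zero_add, ← vertDeriv_apply, ← vertDeriv_apply, map_add, map_smul,
      smul_eq_mul] at this
  have hVV : vertDeriv Lt (navMap L V z) (V z.1) = vertDeriv L z (V z.1) / navFactor L V z := by
    rw [eq_div_iff hlam, navFactor]
    linear_combination hvert (V z.1)
  have hu : ∀ u, vertDeriv Lt (navMap L V z) u = vertDeriv L z u / navFactor L V z := by
    intro u
    have h := hvert u
    rw [hVV] at h
    have h' : vertDeriv Lt (navMap L V z) u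
        = vertDeriv L z u - vertDeriv L z u * (vertDeriv L z (V z.1) / navFactor L V z) := by
      linear_combination h
    rw [h']
    field_simp
    rw [navFactor]; ring
  refine ⟨hu, fun a => ?_⟩
  have h := h2 a 0
  rw [zero_add, fderiv_uncurry_apply Lt, map_add, map_smul, map_smul, hu, hu, smul_eq_mul,
    smul_eq_mul] at h
  have h' : fderiv ℝ (Function.uncurry Lt) (navMap L V z) (a, 0)
      = fderiv ℝ (Function.uncurry L) z (a, 0)
        - (Function.uncurry L z * (vertDeriv L z (fderiv ℝ V z.1 a) / navFactor L V z)
          + fderiv ℝ (Function.uncurry L) z (a, 0)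
            * (vertDeriv L z (V z.1) / navFactor L V z)) := by
    linear_combination h
  rw [h']
  field_simp
  rw [navFactor]; ring

lemma hasFDerivAt_navFactor (hL : ContDiffAt ℝ 2 (Function.uncurry L) z)
    (hV : DifferentiableAt ℝ V z.1) :
    HasFDerivAt (navFactor L V) ((vertDeriv L z).comp
      ((fderiv ℝ V z.1).comp (ContinuousLinearMap.fst ℝ E E))
        + (fderiv ℝ (vertDeriv L) z).flip (V z.1)) z :=
  (hasFDerivAt_vertDeriv_apply hL (hV.hasFDerivAt.comp z hasFDerivAt_fst)).const_add 1

lemma continuousAt_navFactor (hL : ContDiffAt ℝ 2 (Function.uncurry L) z)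
    (hV : DifferentiableAt ℝ V z.1) : ContinuousAt (navFactor L V) z :=
  (hasFDerivAt_navFactor hL hV).continuousAt

lemma fderiv_navFactor_apply (hL : ContDiffAt ℝ 2 (Function.uncurry L) z)
    (hV : DifferentiableAt ℝ V z.1) (a b : E) :
    fderiv ℝ (navFactor L V) z (a, b)
      = vertDeriv L z (fderiv ℝ V z.1 a) + fderiv ℝ (vertDeriv L) z (a, b) (V z.1) := by
  rw [(hasFDerivAt_navFactor hL hV).fderiv]; rfl

/-- Derivatives of the vertical differential of `Lt`, where `Lt ∘ Φ = L`, along the image under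
the differential of `Φ` of a tangent vector `X`. -/
lemma navMap_fderiv_vertDeriv (hL : ContDiffAt ℝ 2 (Function.uncurry L) z)
    (hV : ContDiffAt ℝ 2 V z.1)
    (hLt' : ContDiffAt ℝ 2 (Function.uncurry Lt) (navMap L V z))
    (hlam : navFactor L V z ≠ 0)
    (hLt : ∀ᶠ q in 𝓝 z, Function.uncurry Lt (navMap L V q) = Function.uncurry L q)
    (X : E × E) (u : E) :
    fderiv ℝ (vertDeriv Lt) (navMap L V z) (navMapDeriv L V z X) u
      = fderiv ℝ (vertDeriv L) z X u / navFactor L V z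
        - fderiv ℝ (navFactor L V) z X * vertDeriv L z u / navFactor L V z ^ 2 := by
  have hVd : DifferentiableAt ℝ V z.1 := hV.differentiableAt (by norm_num)
  have hΦ := hasFDerivAt_navMap (hL.differentiableAt (by norm_num)) hVd
  have hev : (fun q => vertDeriv Lt (navMap L V q) u)
      =ᶠ[𝓝 z] fun q => vertDeriv L q u * (navFactor L V q)⁻¹ := by
    have e1 : ∀ᶠ q in 𝓝 z, ContDiffAt ℝ 2 V q.1 :=
      continuousAt_fst.eventually (hV.eventually (by norm_num))
    filter_upwards [hL.eventually (by norm_num), e1,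
      hΦ.continuousAt.eventually (hLt'.eventually (by norm_num)),
      (continuousAt_navFactor hL hVd).eventually_ne hlam,
      eventually_eventually_nhds.mpr hLt] with q h1 h2 h3 h4 h5
    rw [(navMap_first_derivatives (h1.differentiableAt (by norm_num))
      (h2.differentiableAt (by norm_num)) (h3.differentiableAt (by norm_num)) h4 h5).1 u,
      div_eq_mul_inv]
  have hl : HasFDerivAt (fun q => vertDeriv Lt (navMap L V q) u) _ z :=
    (hasFDerivAt_vertDeriv_apply hLt' (hasFDerivAt_const u _)).comp z hΦ
  have hr := (hasFDerivAt_vertDeriv_apply hL (hasFDerivAt_const u z)).mul'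
    ((hasDerivAt_inv hlam).comp_hasFDerivAt z
      (hasFDerivAt_navFactor hL hVd).differentiableAt.hasFDerivAt)
  have := congrArg (fun f => f X) (hl.unique (hr.congr_of_eventuallyEq hev))
  simp at this
  rw [this]
  field_simp
  ring

end NavigationMap

section CoordinateFormula

variable {n : ℕ} {L Lt : Coord n → Coord n → ℝ} {V : Coord n → Coord n} {p v : Coord n}

/-- The determinant of the fundamental tensor of `Lt`, where `Lt ∘ Φ = L`. Write `θ = ∂_v L`,
let `A = 1 + θ ⊗ V` be the vertical differential of `Φ`, of determinant `λ`, and let `g`, `g̃` be the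
fundamental tensors. Then `g̃(A a, A b) = λ⁻¹ g(a, Q b)` with `Q = 1 + ((λ - 1) / L) θ ⊗ v`, which
has determinant `λ` as well, because `θ v = L`. -/
lemma det_hessMatrix_navMap (hL : ContDiffAt ℝ 2 (Function.uncurry L) (p, v))
    (hV : ContDiffAt ℝ 2 V p)
    (hLt' : ContDiffAt ℝ 2 (Function.uncurry Lt) (navMap L V (p, v)))
    (hlam : navFactor L V (p, v) ≠ 0)
    (hLt : ∀ᶠ q in 𝓝 (p, v), Function.uncurry Lt (navMap L V q) = Function.uncurry L q)
    (hpos : L p v ≠ 0)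
    (heuler : ∀ᶠ q in 𝓝 (p, v), vertDeriv L q q.2 = Function.uncurry L q) :
    (hessMatrix Lt (navMap L V (p, v)).1 (navMap L V (p, v)).2).det
      = (navFactor L V (p, v))⁻¹ ^ (n + 1) * (hessMatrix L p v).det := by
  set z : Coord n × Coord n := (p, v) with hz
  set lam := navFactor L V z with hlamdef
  set θ := vertDeriv L z with hθ
  set S := fderiv ℝ (vertDeriv L) z with hS
  set A : Coord n →ₗ[ℝ] Coord n := LinearMap.transvection θ.toLinearMap (V p) with hA
  set Q : Coord n →ₗ[ℝ] Coord n :=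
    LinearMap.transvection θ.toLinearMap (((lam - 1) / L p v) • v) with hQ
  have hAa : ∀ a, A a = a + θ a • V p := fun a => LinearMap.transvection.apply _ _ a
  have hQa : ∀ a, Q a = a + θ a • (((lam - 1) / L p v) • v) :=
    fun a => LinearMap.transvection.apply _ _ a
  have hθv : θ v = L p v := heuler.self_of_nhds
  have hdetA : LinearMap.det A = lam := LinearMap.transvection.det _ _
  have hdetQ : LinearMap.det Q = lam := by
    rw [hQ, LinearMap.transvection.det]
    simp only [ContinuousLinearMap.coe_coe, map_smul, smul_eq_mul, hθv]
    field_simp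
    ring
  have hVd : DifferentiableAt ℝ V z.1 := hV.differentiableAt (by norm_num)
  have hSv : ∀ a, S (0, a) v = 0 := fun a => by
    rw [hS, hz, fderiv_vertDeriv_apply_self hL heuler, Prod.mk_zero_zero, map_zero]
  have hB : (hessForm Lt (navMap L V z).1 (navMap L V z).2).compl₁₂ A A
      = lam⁻¹ • (hessForm L p v).compl₁₂ LinearMap.id Q := by
    refine LinearMap.ext₂ (fun a b => ?_)
    have hfirst := (navMap_first_derivatives (hL.differentiableAt (by norm_num)) hVd
      (hLt'.differentiableAt (by norm_num)) hlam hLt).1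
    have hder : ((0 : Coord n), A a) = navMapDeriv L V z (0, a) := by
      rw [navMapDeriv_apply, map_zero, smul_zero, zero_add, hAa]; rfl
    have hLtz : Lt (navMap L V z).1 (navMap L V z).2 = L p v := hLt.self_of_nhds
    have hlam1 : lam = 1 + θ (V p) := rfl
    rw [LinearMap.compl₁₂_apply, LinearMap.smul_apply, LinearMap.smul_apply, smul_eq_mul,
      LinearMap.compl₁₂_apply, LinearMap.id_apply, hessForm_apply, hessForm_apply, hLtz, hder,
      Prod.mk.eta, navMap_fderiv_vertDeriv hL hV hLt' hlam hLt, hfirst, hfirst,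
      fderiv_navFactor_apply hL hVd, map_zero, map_zero, zero_add, ← hz, ← hθ, ← hS, ← hlamdef,
      hAa, hAa, hQa]
    simp only [map_add, map_smul, smul_eq_mul, hSv, hθv]
    have : θ (V p) = lam - 1 := by rw [hlam1]; ring
    rw [this]
    field_simp
    ring
  have := congrArg gramDet hB
  rw [gramDet_compl₁₂, gramDet_smul, gramDet_compl₁₂, hdetA, hdetQ, LinearMap.det_id, one_mul,
    ← det_hessMatrix hL,
    ← det_hessMatrix (p := (navMap L V z).1) (v := (navMap L V z).2) hLt'] at this
  have hl2 : lam * lam ≠ 0 := mul_ne_zero hlam hlam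
  apply mul_left_cancel₀ hl2
  have hinv : lam * lam⁻¹ = 1 := mul_inv_cancel₀ hlam
  calc _ = lam⁻¹ ^ n * ((hessMatrix L p v).det * lam) := by rw [← this]; ring
    _ = lam * (lam * lam⁻¹) * lam⁻¹ ^ n * (hessMatrix L p v).det := by rw [hinv]; ring
    _ = _ := by rw [pow_succ]; ring

/-- The geodesic spray annihilates `L`, and satisfies the Euler-Lagrange equation of `L`. -/
lemma spray_euler_lagrange (hL : ContDiffAt ℝ 2 (Function.uncurry L) (p, v))
    (hdet : (hessMatrix L p v).det ≠ 0) (hpos : L p v ≠ 0)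
    (heuler : ∀ᶠ q in 𝓝 (p, v), vertDeriv L q q.2 = Function.uncurry L q) :
    fderiv ℝ (Function.uncurry L) (p, v) (v, (-2 : ℝ) • sprayCoeff L p v) = 0 ∧
    ∀ u, fderiv ℝ (vertDeriv L) (p, v) (v, (-2 : ℝ) • sprayCoeff L p v) u
      = fderiv ℝ (Function.uncurry L) (p, v) (u, 0) := by
  have hEL := (neg_two_smul_sprayCoeff_eq_iff hL hdet _).mp rfl
  set b := (-2 : ℝ) • sprayCoeff L p v with hb
  have hθv : vertDeriv L (p, v) v = L p v := heuler.self_of_nhds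
  have h3 := fderiv_vertDeriv_apply_self hL heuler v b
  have h4 := hEL v
  rw [hθv] at h4
  have h0 : fderiv ℝ (Function.uncurry L) (p, v) (v, b) = 0 := by
    have h6 : L p v * fderiv ℝ (Function.uncurry L) (p, v) (v, b) = 0 := by
      linear_combination h4 - L p v * h3
    exact (mul_eq_zero.mp h6).resolve_left hpos
  refine ⟨h0, fun u => ?_⟩
  have h7 := hEL u
  rw [h0, zero_mul, add_zero] at h7
  exact mul_left_cancel₀ hpos h7

/-- The S-curvature of `Lt`, where `Lt ∘ Φ = L` and the field `V` satisfies the infinitesimal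
homothety equation `hkill`, in coordinates. The hypotheses `hτ` and `hτ0` say that the distortion of
`L` is invariant under the flow of `V` and homogeneous of degree zero in the direction. -/
theorem coordSCurvature_navMap {σ : Coord n → ℝ} {c : ℝ}
    (hL : ContDiffAt ℝ 3 (Function.uncurry L) (p, v)) (hV : ContDiffAt ℝ 3 V p)
    (hlam : navFactor L V (p, v) ≠ 0)
    (hLt : ∀ᶠ q in 𝓝 (p, v), Function.uncurry Lt (navMap L V q) = Function.uncurry L q)
    (hpos : L p v ≠ 0) (hdet : (hessMatrix L p v).det ≠ 0)
    (heuler : ∀ᶠ q in 𝓝 (p, v), vertDeriv L q q.2 = Function.uncurry L q)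
    (hkill : ∀ᶠ w in 𝓝 v,
      fderiv ℝ (Function.uncurry L) (p, w) (V p, fderiv ℝ V p w) = -2 * c * L p w)
    (hσ : DifferentiableAt ℝ σ p) (hσ0 : σ p ≠ 0)
    (hτ : fderiv ℝ (fun q : Coord n × Coord n => distortion L σ q.1 q.2) (p, v)
      (V p, fderiv ℝ V p v) = 0)
    (hτ0 : fderiv ℝ (fun q : Coord n × Coord n => distortion L σ q.1 q.2) (p, v) (0, v) = 0) :
    coordSCurvature Lt σ p (v + L p v • V p)
      = coordSCurvature L σ p v + ((n : ℝ) + 1) * c * L p v := by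
  have hL2 : ContDiffAt ℝ 2 (Function.uncurry L) (p, v) := hL.of_le (by norm_num)
  have hL1 : DifferentiableAt ℝ (Function.uncurry L) (p, v) := hL.differentiableAt (by norm_num)
  have hV2 : ContDiffAt ℝ 2 V p := hV.of_le (by norm_num)
  have hVd : DifferentiableAt ℝ V p := hV.differentiableAt (by norm_num)
  have hLt3 : ContDiffAt ℝ 3 (Function.uncurry Lt) (navMap L V (p, v)) :=
    contDiffAt_of_navMap (by norm_num) hL hV hlam hLt
  have hLt2 : ContDiffAt ℝ 2 (Function.uncurry Lt) (navMap L V (p, v)) := hLt3.of_le (by norm_num)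
  have hΦ := hasFDerivAt_navMap (z := (p, v)) hL1 hVd
  obtain ⟨hspray0, hspray⟩ := spray_euler_lagrange hL2 hdet hpos heuler
  set b := (-2 : ℝ) • sprayCoeff L p v with hb
  set D := fderiv ℝ (Function.uncurry L) (p, v) with hD
  set θ := vertDeriv L (p, v) with hθ
  set S := fderiv ℝ (vertDeriv L) (p, v) with hS
  set lam := navFactor L V (p, v) with hlamdef
  have hθv : θ v = L p v := heuler.self_of_nhds
  have hkill0 : D (V p, fderiv ℝ V p v) = -2 * c * L p v := hkill.self_of_nhds
  -- The vertical derivative of the infinitesimal homothety equation.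
  have hSW : ∀ u, S (V p, fderiv ℝ V p v) u = -θ (fderiv ℝ V p u) - 2 * c * θ u := by
    intro u
    have hD1 : DifferentiableAt ℝ (fderiv ℝ (Function.uncurry L)) (p, v) :=
      (hL2.fderiv_right (m := 1) (by norm_num)).differentiableAt (by norm_num)
    have hin : HasFDerivAt (fun q : Coord n × Coord n => (V p, fderiv ℝ V p q.2))
        ((0 : Coord n × Coord n →L[ℝ] Coord n).prod
          ((fderiv ℝ V p).comp (ContinuousLinearMap.snd ℝ (Coord n) (Coord n)))) (p, v) :=
      (hasFDerivAt_const (V p) (p, v)).prodMk ((fderiv ℝ V p).hasFDerivAt.comp (p, v)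
        hasFDerivAt_snd)
    have h1 := hasDerivAt_comp_vertical_line (hD1.hasFDerivAt.clm_apply hin) u
    have h2 := (hasDerivAt_vertical_line hL1 u).const_mul (-2 * c)
    have hline : Tendsto (fun t : ℝ => v + t • u) (𝓝 0) (𝓝 v) := by
      have : ContinuousAt (fun t : ℝ => v + t • u) 0 := by fun_prop
      simpa using this.tendsto
    have hev : ∀ᶠ t : ℝ in 𝓝 0, fderiv ℝ (Function.uncurry L) (p, v + t • u)
        (V p, fderiv ℝ V p (v + t • u)) = -2 * c * L p (v + t • u) := hline.eventually hkill
    have h3 := h1.unique (h2.congr_of_eventuallyEq hev)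
    simp only [add_apply, ContinuousLinearMap.comp_apply, ContinuousLinearMap.prod_apply,
      ContinuousLinearMap.flip_apply, ContinuousLinearMap.coe_snd', zero_apply] at h3
    rw [second_fderiv_symm hL2, ← fderiv_vertDeriv_apply hL2, ← vertDeriv_apply] at h3
    linear_combination h3
  have hSv : ∀ u, S (0, v) u = 0 := fderiv_vertDeriv_self hL2 heuler
  -- The pull-back by `Φ` of the spray of `Lt`: its component on the base has to be `v + L V`, and the
  -- multiple of the radial field makes it annihilate `L`.
  set X : Coord n × Coord n :=
    (v, b) + L p v • ((V p, fderiv ℝ V p v) + (2 * c) • ((0 : Coord n), v)) with hX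
  have hX1 : X = (v + L p v • V p, b + L p v • (fderiv ℝ V p v + (2 * c) • v)) := by
    rw [hX]; simp
  have hDX : D X = 0 := by
    rw [hX, map_add, map_smul, map_add, map_smul, hspray0, hkill0, ← vertDeriv_apply, ← hθ, hθv]
    simp only [smul_eq_mul]; ring
  have hSX : ∀ u, S X u = D (u, 0) - L p v * (θ (fderiv ℝ V p u) + 2 * c * θ u) := by
    intro u
    rw [hX, map_add, map_smul, map_add, map_smul]
    simp only [add_apply, smul_apply, smul_eq_mul, hspray, hSW, hSv]
    ring
  -- The term `(n + 1) c L` of the result comes from this derivative of `λ` along the spray.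
  have hlamX : fderiv ℝ (navFactor L V) (p, v) X = -2 * c * L p v * lam := by
    have h1 : lam = 1 + θ (V p) := rfl
    have h2 : D (V p, fderiv ℝ V p v) = D (V p, 0) + θ (fderiv ℝ V p v) :=
      fderiv_uncurry_apply L (p, v) _ _
    have h3 := fderiv_navFactor_apply hL2 (V := V) (z := (p, v)) hVd X.1 X.2
    rw [Prod.mk.eta, ← hS, ← hθ, hSX] at h3
    rw [h3, hX1, h1]
    simp only [map_add, map_smul, smul_eq_mul]
    linear_combination hkill0 - h2
  -- The image of `X` under the differential of the navigation map is the spray of `Lt`.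
  have hdett := det_hessMatrix_navMap hL2 hV2 hLt2 hlam hLt hpos heuler
  have hdett0 : (hessMatrix Lt (navMap L V (p, v)).1 (navMap L V (p, v)).2).det ≠ 0 := by
    rw [hdett]
    exact mul_ne_zero (pow_ne_zero _ (inv_ne_zero hlam)) hdet
  have hfirst := navMap_first_derivatives (z := (p, v)) hL1 hVd
    (hLt2.differentiableAt (by norm_num)) hlam hLt
  have himage : navMapDeriv L V (p, v) X
      = (v + L p v • V p, (-2 : ℝ) • sprayCoeff Lt p (v + L p v • V p)) := by
    have h1 : (navMapDeriv L V (p, v) X).1 = v + L p v • V p := by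
      rw [hX1, navMapDeriv_apply]
    have h2 : ((v + L p v • V p), (navMapDeriv L V (p, v) X).2) = navMapDeriv L V (p, v) X := by
      rw [← h1]
    have h3 := (neg_two_smul_sprayCoeff_eq_iff (p := p) (v := v + L p v • V p) hLt2 hdett0
      (navMapDeriv L V (p, v) X).2).mpr ?_
    · rw [h3, h2]
    intro u
    have hz : navMap L V (p, v) = (p, v + L p v • V p) := rfl
    have hzero : fderiv ℝ (Function.uncurry Lt) (navMap L V (p, v)) (navMapDeriv L V (p, v) X)
        = 0 := by
      rw [← hDX]
      exact congrArg (fun f => f X) (((hLt2.differentiableAt (by norm_num)).hasFDerivAt.comp (p, v)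
        hΦ).unique (hL1.hasFDerivAt.congr_of_eventuallyEq hLt))
    rw [← hz, h2, hzero, zero_mul, add_zero]
    congr 1
    rw [navMap_fderiv_vertDeriv hL2 hV2 hLt2 hlam hLt, hfirst.2, hlamX, ← hS, ← hθ, ← hD, hSX,
      ← hlamdef]
    have : Function.uncurry L (p, v) = L p v := rfl
    rw [this]
    field_simp
    ring
  -- The distortions of `Lt` and of `L` differ by a multiple of `log |λ|`. The value `Real.log λ` is
  -- `log |λ|` also for negative `λ`.
  have hτd := differentiableAt_distortion hL hdet hσ hσ0
  have hτtd := differentiableAt_distortion (σ := σ) hLt3 hdett0 hσ hσ0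
  have hlamd := (hasFDerivAt_navFactor hL2 (V := V) (z := (p, v)) hVd).differentiableAt.hasFDerivAt
  have hev : (fun q : Coord n × Coord n =>
        distortion Lt σ (navMap L V q).1 (navMap L V q).2) =ᶠ[𝓝 (p, v)]
      fun q => distortion L σ q.1 q.2 - ((n + 1 : ℕ) / 2 : ℝ) * Real.log (navFactor L V q) := by
    have e1 : ∀ᶠ q : Coord n × Coord n in 𝓝 (p, v), ContDiffAt ℝ 2 V q.1 :=
      continuousAt_fst.eventually (hV2.eventually (by norm_num))
    have e2 : ∀ᶠ q : Coord n × Coord n in 𝓝 (p, v), σ q.1 ≠ 0 :=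
      (continuousAt_fst (p := (p, v))).eventually
        (p := fun q => σ q ≠ 0) (hσ.continuousAt.eventually_ne hσ0)
    filter_upwards [hL2.eventually (by norm_num), e1, e2,
      hΦ.continuousAt.eventually (hLt2.eventually (by norm_num)),
      hlamd.continuousAt.eventually_ne hlam,
      eventually_eventually_nhds.mpr hLt, eventually_eventually_nhds.mpr heuler,
      hL1.continuousAt.eventually_ne (y := 0) hpos,
      (contDiffAt_det_hessMatrix hL).continuousAt.eventually_ne hdet]
      with q h1 h2 h3 h4 h5 h6 h7 h8 h9
    have hq := det_hessMatrix_navMap (p := q.1) (v := q.2) h1 h2 h4 h5 h6 h8 h7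
    have hq0 : (hessMatrix Lt (navMap L V q).1 (navMap L V q).2).det ≠ 0 := by
      rw [show navMap L V q = navMap L V (q.1, q.2) from rfl, hq]
      exact mul_ne_zero (pow_ne_zero _ (inv_ne_zero h5)) h9
    rw [distortion_eq hq0 h3, distortion_eq h9 h3,
      show navMap L V q = navMap L V (q.1, q.2) from rfl, hq,
      Real.log_mul (pow_ne_zero _ (inv_ne_zero h5)) h9, Real.log_pow, Real.log_inv]
    simp only [navMap]
    ring
  have hl := hτtd.hasFDerivAt.comp (p, v) hΦ
  have hr := hτd.hasFDerivAt.sub ((hlamd.log hlam).const_mul ((n + 1 : ℕ) / 2 : ℝ))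
  have hfin := congrArg (fun f => f X) (hl.unique (hr.congr_of_eventuallyEq hev))
  simp only [ContinuousLinearMap.comp_apply, sub_apply, smul_apply,
    smul_eq_mul, hlamX, himage] at hfin
  have hτX : fderiv ℝ (fun q : Coord n × Coord n => distortion L σ q.1 q.2) (p, v) X
      = coordSCurvature L σ p v := by
    rw [hX, map_add, map_smul, map_add, map_smul, hτ, hτ0, coordSCurvature]
    simp only [smul_zero, add_zero]
    rw [hb]
  rw [hτX] at hfin
  rw [coordSCurvature]
  refine hfin.trans ?_
  rw [← hlamdef]
  field_simp
  push_cast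
  ring

end CoordinateFormula

/-! ### The fundamental inequality of Finsler norms -/

/-- Finsler metrics `L = L(p, v)` over an open subset `U` of `ℝⁿ`. For `n ≠ 0`, homogeneity with
`r = 0` gives `L(p, 0) = 0`. Smoothness is required only away from
the zero section. -/
structure IsFinslerOn {n : ℕ} (L : Coord n → Coord n → ℝ) (U : Set (Coord n)) : Prop where
  isOpen : IsOpen U
  contDiffOn : ContDiffOn ℝ ∞ (Function.uncurry L) (U ×ˢ {0}ᶜ)
  pos : ∀ p ∈ U, ∀ v, v ≠ 0 → 0 < L p v
  homogeneous : ∀ p ∈ U, ∀ v, v ≠ 0 → ∀ r : ℝ, 0 ≤ r → L p (r • v) = r * L p v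
  strong_convex : ∀ p ∈ U, ∀ v, v ≠ 0 → ∀ u, u ≠ 0 → 0 < fundTensor (L p) v u u

namespace IsFinslerOn

variable {n : ℕ} {L : Coord n → Coord n → ℝ} {U : Set (Coord n)} {p v : Coord n}

lemma isOpen_prod (hL : IsFinslerOn L U) : IsOpen (U ×ˢ ({0}ᶜ : Set (Coord n))) :=
  hL.isOpen.prod isOpen_compl_singleton

lemma contDiffAt (hL : IsFinslerOn L U) (hp : p ∈ U) (hv : v ≠ 0) :
    ContDiffAt ℝ ∞ (Function.uncurry L) (p, v) :=
  hL.contDiffOn.contDiffAt (hL.isOpen_prod.mem_nhds ⟨hp, hv⟩)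

lemma contDiffAt_two (hL : IsFinslerOn L U) (hp : p ∈ U) (hv : v ≠ 0) :
    ContDiffAt ℝ 2 (Function.uncurry L) (p, v) :=
  (hL.contDiffAt hp hv).of_le ENat.LEInfty.out

lemma differentiableAt (hL : IsFinslerOn L U) (hp : p ∈ U) (hv : v ≠ 0) :
    DifferentiableAt ℝ (Function.uncurry L) (p, v) :=
  (hL.contDiffAt hp hv).differentiableAt (by simp)

lemma apply_zero (hL : IsFinslerOn L U) (hp : p ∈ U) (hv : v ≠ 0) : L p 0 = 0 := by
  simpa using hL.homogeneous p hp v hv 0 le_rfl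

lemma nonneg (hL : IsFinslerOn L U) (hp : p ∈ U) (hv : v ≠ 0) (w : Coord n) : 0 ≤ L p w := by
  rcases eq_or_ne w 0 with rfl | hw
  · rw [hL.apply_zero hp hv]
  · exact (hL.pos p hp w hw).le

/-- Euler's identity. -/
lemma vertDeriv_self (hL : IsFinslerOn L U) (hp : p ∈ U) (hv : v ≠ 0) :
    vertDeriv L (p, v) v = L p v := by
  have h1 := hasDerivAt_vertical_line (hL.differentiableAt hp hv) v
  have h2 : HasDerivAt (fun t : ℝ => (1 + t) * L p v) (L p v) 0 := by
    simpa using ((hasDerivAt_id (0 : ℝ)).const_add 1).mul_const (L p v)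
  refine h1.unique (h2.congr_of_eventuallyEq ?_)
  filter_upwards [lt_mem_nhds (show (-1 : ℝ) < 0 by norm_num)] with t ht
  rw [← hL.homogeneous p hp v hv (1 + t) (by linarith), add_smul, one_smul]

lemma eventually_euler (hL : IsFinslerOn L U) (hp : p ∈ U) (hv : v ≠ 0) :
    ∀ᶠ q in 𝓝 (p, v), vertDeriv L q q.2 = Function.uncurry L q := by
  filter_upwards [hL.isOpen_prod.mem_nhds ⟨hp, hv⟩] with q hq
  exact hL.vertDeriv_self hq.1 hq.2

lemma fundTensor_self_left (hL : IsFinslerOn L U) (hp : p ∈ U) (hv : v ≠ 0) (u : Coord n) :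
    fundTensor (L p) v v u = L p v * vertDeriv L (p, v) u := by
  rw [fundTensor_eq (hL.contDiffAt_two hp hv),
    fderiv_vertDeriv_self (hL.contDiffAt_two hp hv) (hL.eventually_euler hp hv),
    hL.vertDeriv_self hp hv]
  ring

/-- Convexity of `L²` along a segment which avoids the origin. -/
lemma sq_add_le_of_segment (hL : IsFinslerOn L U) (hp : p ∈ U) {u : Coord n}
    (hseg : ∀ t ∈ Set.Icc (0 : ℝ) 1, v + t • u ≠ 0) :
    L p v ^ 2 + 2 * (L p v * vertDeriv L (p, v) u) ≤ L p (v + u) ^ 2 := by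
  set φ : ℝ → ℝ := fun t => L p (v + t • u) ^ 2 with hφ
  set ψ : ℝ → ℝ := fun t => 2 * (L p (v + t • u) * vertDeriv L (p, v + t • u) u) with hψ
  have hshift : ∀ (s t : ℝ), v + t • u + (s - t) • u = v + s • u := by
    intro s t; rw [add_assoc, ← add_smul]; congr 2; ring
  have hLd : ∀ t ∈ Set.Icc (0 : ℝ) 1,
      HasDerivAt (fun s => L p (v + s • u)) (vertDeriv L (p, v + t • u) u) t := by
    intro t ht
    have h1 := hasDerivAt_vertical_line (hL.differentiableAt hp (hseg t ht)) u
    have h2 := HasDerivAt.comp_sub_const t t (by simpa using h1)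
    simpa [hshift] using h2
  have hφd : ∀ t ∈ Set.Icc (0 : ℝ) 1, HasDerivAt φ (ψ t) t := by
    intro t ht
    have := (hLd t ht).fun_pow 2
    refine this.congr_deriv ?_
    simp only [hψ]; ring
  have hψd : ∀ t ∈ Set.Icc (0 : ℝ) 1,
      HasDerivAt ψ (2 * fundTensor (L p) (v + t • u) u u) t := by
    intro t ht
    have h0 := hL.contDiffAt_two hp (hseg t ht)
    have h1 := hasDerivAt_comp_vertical_line
      (hasFDerivAt_vertDeriv_apply h0 (hasFDerivAt_const u _)) u
    have h2 := HasDerivAt.comp_sub_const t t (by simpa using h1)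
    simp only [hshift] at h2
    have := ((hLd t ht).fun_mul h2).const_mul 2
    refine this.congr_deriv ?_
    rw [fundTensor_eq h0]
    ring
  have hmono : MonotoneOn ψ (Set.Icc 0 1) := by
    refine monotoneOn_of_deriv_nonneg (convex_Icc 0 1)
      (fun t ht => (hψd t ht).continuousAt.continuousWithinAt)
      (fun t ht => (hψd t (interior_subset ht)).differentiableAt.differentiableWithinAt)
      (fun t ht => ?_)
    rw [(hψd t (interior_subset ht)).deriv]
    rcases eq_or_ne u 0 with rfl | hu
    · rw [fundTensor_eq (hL.contDiffAt_two hp (hseg t (interior_subset ht)))]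
      simp
    · have := hL.strong_convex p hp _ (hseg t (interior_subset ht)) u hu
      positivity
  obtain ⟨ξ, hξ, hslope⟩ := exists_hasDerivAt_eq_slope φ ψ zero_lt_one
    (fun t ht => (hφd t ht).continuousAt.continuousWithinAt)
    (fun t ht => hφd t (Set.Ioo_subset_Icc_self ht))
  have h1 := hmono (Set.left_mem_Icc.mpr zero_le_one) (Set.Ioo_subset_Icc_self hξ) hξ.1.le
  rw [hslope] at h1
  simp only [hφ, hψ, zero_smul, add_zero, one_smul, sub_zero, div_one] at h1
  linarith

/-- The fundamental inequality `∂_v L(p, v) w ≤ L(p, w)`. When `w` is a nonpositive multiple of `v`,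
where the segment from `v` to a multiple of `w` meets the origin, the left-hand side is nonpositive.
Otherwise `L²` is convex along such segments. -/
lemma vertDeriv_le (hL : IsFinslerOn L U) (hp : p ∈ U) (hv : v ≠ 0) (w : Coord n) :
    vertDeriv L (p, v) w ≤ L p w := by
  have hLv := hL.pos p hp v hv
  by_cases hex : ∃ k : ℝ, 0 ≤ k ∧ w = (-k) • v
  · obtain ⟨k, hk, rfl⟩ := hex
    rw [map_smul, hL.vertDeriv_self hp hv, smul_eq_mul]
    have := hL.nonneg hp hv ((-k) • v)
    nlinarith
  · push Not at hex
    have hw : w ≠ 0 := by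
      intro h
      exact hex 0 le_rfl (by simp [h])
    have hLw := hL.pos p hp w hw
    -- The factor `r` normalises `w` so that `L(r w) = L(v)`.
    set r : ℝ := L p v / L p w with hr
    have hr0 : 0 < r := div_pos hLv hLw
    have hseg : ∀ t ∈ Set.Icc (0 : ℝ) 1, v + t • (r • w - v) ≠ 0 := by
      intro t ht h0
      have h1 : (t * r) • w = (-(1 - t)) • v := by
        have : (1 - t) • v + (t * r) • w = 0 := by
          rw [← h0]; module
        rw [neg_smul]
        exact eq_neg_of_add_eq_zero_right this
      rcases eq_or_lt_of_le ht.1 with h | h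
      · rw [← h] at h0
        simp at h0
        exact hv h0
      · apply hex ((1 - t) / (t * r)) (div_nonneg (by linarith [ht.2]) (by positivity))
        have htr : t * r ≠ 0 := by positivity
        rw [← inv_smul_smul₀ htr w, h1, smul_smul]
        congr 1
        field_simp
    have h := hL.sq_add_le_of_segment hp hseg
    rw [add_sub_cancel, map_sub, map_smul, hL.vertDeriv_self hp hv,
      hL.homogeneous p hp w hw r hr0.le, smul_eq_mul] at h
    have hrw : r * L p w = L p v := by rw [hr]; field_simp
    rw [hrw] at h
    have h2 : L p v * (r * vertDeriv L (p, v) w) ≤ L p v * (r * L p w) := by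
      rw [hrw]; nlinarith
    exact le_of_mul_le_mul_left (le_of_mul_le_mul_left h2 hLv) hr0

/-- The navigation map is injective on the cone where `∂_v L(V) < -1`. Two preimages `v`, `w` of a
vector differ by the multiple `L(w) - L(v)` of `V`, so if `L(v) < L(w)`, then the fundamental
inequality at `v` is violated. -/
lemma navigation_unique (hL : IsFinslerOn L U) (hp : p ∈ U) {v w V : Coord n} (hv : v ≠ 0)
    (hw : w ≠ 0) (hvV : vertDeriv L (p, v) V < -1) (hwV : vertDeriv L (p, w) V < -1)
    (h : v + L p v • V = w + L p w • V) : v = w := by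
  have key : ∀ v w : Coord n, v ≠ 0 → w ≠ 0 → vertDeriv L (p, v) V < -1 →
      v + L p v • V = w + L p w • V → L p w ≤ L p v := by
    intro v w hv hw hvV h
    by_contra! hlt
    have hwe : w = v - (L p w - L p v) • V := by
      rw [sub_smul, eq_sub_iff_add_eq, add_sub, ← h, add_sub_cancel_right]
    have h1 := hL.vertDeriv_le hp hv w
    have h2 : vertDeriv L (p, v) w = L p v - (L p w - L p v) * vertDeriv L (p, v) V := by
      conv_lhs => rw [hwe]
      rw [map_sub, map_smul, hL.vertDeriv_self hp hv, smul_eq_mul]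
    nlinarith
  have heq : L p v = L p w :=
    le_antisymm (key w v hw hv hwV h.symm) (key v w hv hw hvV h)
  rw [heq] at h
  exact add_right_cancel h

end IsFinslerOn

/-! ### The volume of the unit balls -/

lemma volumeIoiPow_apply_Iic (m : ℕ) (x : Set.Ioi (0 : ℝ)) :
    Measure.volumeIoiPow m (Set.Iic x) = ENNReal.ofReal (x.1 ^ (m + 1) / (m + 1)) := by
  have h0 : Measure.volumeIoiPow m {x} = 0 := by
    refine withDensity_absolutelyContinuous _ _ ?_
    rw [(MeasurableEmbedding.subtype_coe measurableSet_Ioi).comap_apply]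
    simp
  have h1 : Set.Iic x = Set.Iio x ∪ {x} := Set.Iio_union_right.symm
  refine le_antisymm ?_ ?_
  · rw [h1]
    refine (measure_union_le _ _).trans ?_
    rw [h0, add_zero, Measure.volumeIoiPow_apply_Iio]
  · rw [← Measure.volumeIoiPow_apply_Iio]
    exact measure_mono Set.Iio_subset_Iic_self

namespace IsFinslerOn

variable {n : ℕ} {L : Coord n → Coord n → ℝ} {U : Set (Coord n)} {p : Coord n}

lemma continuous_inv_pow (hL : IsFinslerOn L U) (hp : p ∈ U) :
    Continuous (fun θ : Metric.sphere (0 : Coord n) 1 => ((L p θ) ^ n)⁻¹) := by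
  have h1 : Continuous (fun θ : Metric.sphere (0 : Coord n) 1 => L p θ) := by
    refine hL.contDiffOn.continuousOn.comp_continuous (f := fun θ : Metric.sphere (0 : Coord n) 1 =>
      (p, (θ : Coord n))) (by fun_prop) (fun θ => ⟨hp, ?_⟩)
    exact ne_zero_of_mem_unit_sphere θ
  exact (h1.pow n).inv₀ (fun θ => (pow_pos (hL.pos p hp _ (ne_zero_of_mem_unit_sphere θ)) n).ne')

/-- The volume of the unit ball of a Finsler norm in polar coordinates. In this form its
dependence on the base point is accessible to differentiation under the integral sign. -/
lemma volume_ball_eq (hL : IsFinslerOn L U) (hp : p ∈ U) (hn : n ≠ 0) :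
    volume.real {v : Coord n | L p v ≤ 1}
      = ∫ θ, ((L p θ) ^ n)⁻¹ / n ∂(volume : Measure (Coord n)).toSphere := by
  obtain ⟨m, rfl⟩ := Nat.exists_eq_succ_of_ne_zero hn
  set μ : Measure (Coord (m + 1)) := volume with hμ
  set B : Set (Coord (m + 1)) := {v | L p v ≤ 1} with hB
  have hpos : ∀ θ : Metric.sphere (0 : Coord (m + 1)) 1, 0 < L p θ :=
    fun θ => hL.pos p hp _ (ne_zero_of_mem_unit_sphere θ)
  have hcont : Continuous (fun w : ({0}ᶜ : Set (Coord (m + 1))) => L p w) :=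
    hL.contDiffOn.continuousOn.comp_continuous (f := fun w : ({0}ᶜ : Set (Coord (m + 1))) =>
      (p, (w : Coord (m + 1)))) (by fun_prop) (fun w => ⟨hp, w.2⟩)
  set S : Set (({0}ᶜ : Set (Coord (m + 1)))) := {w | L p w ≤ 1} with hS
  have hSm : MeasurableSet S := measurableSet_le hcont.measurable measurable_const
  have h1 : μ B = (μ.comap Subtype.val) S := by
    rw [(MeasurableEmbedding.subtype_coe
      (measurableSet_singleton (0 : Coord (m + 1))).compl).comap_apply]
    have : Subtype.val '' S = B \ {0} := by
      ext w
      simp only [hS, hB, Set.mem_image, Set.mem_ofPred_eq, Subtype.exists, Set.mem_sdiff]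
      constructor
      · rintro ⟨a, ha, h, rfl⟩
        exact ⟨h, ha⟩
      · rintro ⟨h, ha⟩
        exact ⟨w, ha, h, rfl⟩
    rw [this, measure_sdiff_null (measure_singleton _)]
  have hmp := μ.measurePreserving_homeomorphUnitSphereProd
  set T : Set (Metric.sphere (0 : Coord (m + 1)) 1 × Set.Ioi (0 : ℝ)) :=
    (homeomorphUnitSphereProd (Coord (m + 1))).symm ⁻¹' S with hT
  have hTm : MeasurableSet T := (homeomorphUnitSphereProd _).symm.continuous.measurable hSm
  have h2 : (μ.comap Subtype.val) S
      = (μ.toSphere.prod (Measure.volumeIoiPow (Module.finrank ℝ (Coord (m + 1)) - 1))) T := by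
    rw [← hmp.measure_preimage hTm.nullMeasurableSet]
    congr 1
    ext w
    simp [hT]
  have hdim : Module.finrank ℝ (Coord (m + 1)) - 1 = m := by simp
  have h3 : ∀ θ : Metric.sphere (0 : Coord (m + 1)) 1,
      Measure.volumeIoiPow m (Prod.mk θ ⁻¹' T)
        = ENNReal.ofReal (((L p θ) ^ (m + 1))⁻¹ / ((m + 1 : ℕ) : ℝ)) := by
    intro θ
    have hset : Prod.mk θ ⁻¹' T =
        Set.Iic (⟨(L p θ)⁻¹, inv_pos.mpr (hpos θ)⟩ : Set.Ioi (0 : ℝ)) := by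
      ext r
      simp only [hT, hS, Set.mem_preimage, Set.mem_ofPred_eq, Set.mem_Iic,
        homeomorphUnitSphereProd_symm_apply_coe]
      rw [hL.homogeneous p hp _ (ne_zero_of_mem_unit_sphere θ) r.1 (le_of_lt r.2),
        ← Subtype.coe_le_coe, ← le_div_iff₀ (hpos θ), one_div]
    rw [hset, volumeIoiPow_apply_Iic]
    simp
  rw [Measure.real, h1, h2, hdim, Measure.prod_apply hTm]
  simp only [h3]
  rw [integral_eq_lintegral_of_nonneg_ae]
  · refine Eventually.of_forall (fun θ => ?_)
    have := hpos θ
    simp only [Pi.zero_apply]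
    positivity
  · exact ((hL.continuous_inv_pow hp).div_const _).aestronglyMeasurable

lemma volume_ball_pos (hL : IsFinslerOn L U) (hp : p ∈ U) (hn : n ≠ 0) :
    0 < volume.real {v : Coord n | L p v ≤ 1} := by
  rw [hL.volume_ball_eq hp hn]
  have hpos : ∀ θ : Metric.sphere (0 : Coord n) 1, 0 < ((L p θ) ^ n)⁻¹ / n := by
    intro θ
    have := hL.pos p hp _ (ne_zero_of_mem_unit_sphere θ)
    have : 0 < n := Nat.pos_of_ne_zero hn
    positivity
  have hc : Continuous (fun θ : Metric.sphere (0 : Coord n) 1 => ((L p θ) ^ n)⁻¹ / n) :=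
    (hL.continuous_inv_pow hp).div_const _
  rw [integral_pos_iff_support_of_nonneg (fun θ => (hpos θ).le)
    (hc.integrable_of_hasCompactSupport (HasCompactSupport.of_compactSpace _))]
  have hsupp : Function.support (fun θ : Metric.sphere (0 : Coord n) 1 => ((L p θ) ^ n)⁻¹ / n)
      = Set.univ := Set.eq_univ_of_forall (fun θ => (hpos θ).ne')
  have : Nontrivial (Coord n) := by
    have : Nonempty (Fin n) := ⟨⟨0, Nat.pos_of_ne_zero hn⟩⟩
    infer_instance
  rw [hsupp, Measure.measure_univ_pos]
  exact Measure.toSphere_ne_zero _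

/-- The volume of the unit ball of a Finsler metric depends differentiably on the base point. -/
lemma differentiableAt_volume_ball (hL : IsFinslerOn L U) (hp : p ∈ U) (hn : n ≠ 0) :
    DifferentiableAt ℝ (fun q => volume.real {v : Coord n | L q v ≤ 1}) p := by
  have hev : (fun q => volume.real {v : Coord n | L q v ≤ 1}) =ᶠ[𝓝 p]
      fun q => ∫ θ, ((L q θ) ^ n)⁻¹ / n ∂(volume : Measure (Coord n)).toSphere := by
    filter_upwards [hL.isOpen.mem_nhds hp] with q hq
    exact hL.volume_ball_eq hq hn
  refine DifferentiableAt.congr_of_eventuallyEq ?_ hev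
  set O := U ×ˢ ({0}ᶜ : Set (Coord n)) with hO
  set G : Coord n × Coord n → ℝ := fun z => ((Function.uncurry L z) ^ n)⁻¹ / n with hG
  have hGd : ContDiffOn ℝ 1 G O := by
    have h1 : ContDiffOn ℝ 1 (Function.uncurry L) O :=
      hL.contDiffOn.of_le ENat.LEInfty.out
    exact ((h1.pow n).inv (fun z hz => (pow_pos (hL.pos _ hz.1 _ hz.2) n).ne')).div_const _
  have hG' : ContinuousOn (fderiv ℝ G) O :=
    hGd.continuousOn_fderiv_of_isOpen hL.isOpen_prod le_rfl
  obtain ⟨ε, hε, hball⟩ := Metric.nhds_basis_closedBall.mem_iff.mp (hL.isOpen.mem_nhds hp)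
  have hsub : Metric.closedBall p ε ×ˢ Metric.sphere (0 : Coord n) 1 ⊆ O := by
    rintro ⟨q, w⟩ ⟨hq, hw⟩
    exact ⟨hball hq, ne_zero_of_mem_unit_sphere ⟨w, hw⟩⟩
  obtain ⟨C, hC⟩ := ((isCompact_closedBall p ε).prod
    (isCompact_sphere (0 : Coord n) 1)).exists_bound_of_continuousOn (hG'.mono hsub)
  set F' : Coord n → Metric.sphere (0 : Coord n) 1 → Coord n →L[ℝ] ℝ := fun q θ =>
    (fderiv ℝ G (q, θ)).comp (ContinuousLinearMap.inl ℝ (Coord n) (Coord n)) with hF'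
  have hcont : ∀ q ∈ U, Continuous
      (fun θ : Metric.sphere (0 : Coord n) 1 => ((L q θ) ^ n)⁻¹ / n) :=
    fun q hq => (hL.continuous_inv_pow hq).div_const _
  have := hasFDerivAt_integral_of_dominated_of_fderiv_le (𝕜 := ℝ)
    (μ := (volume : Measure (Coord n)).toSphere)
    (F := fun (q : Coord n) (θ : Metric.sphere (0 : Coord n) 1) => ((L q θ) ^ n)⁻¹ / n)
    (F' := F') (x₀ := p) (bound := fun _ => C * ‖ContinuousLinearMap.inl ℝ (Coord n) (Coord n)‖)
    (Metric.ball_mem_nhds p hε) ?_ ?_ ?_ ?_ (integrable_const _) ?_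
  · exact this.differentiableAt
  · filter_upwards [hL.isOpen.mem_nhds hp] with q hq
    exact (hcont q hq).aestronglyMeasurable
  · exact (hcont p hp).integrable_of_hasCompactSupport (HasCompactSupport.of_compactSpace _)
  · have h1 : Continuous (fun θ : Metric.sphere (0 : Coord n) 1 =>
        fderiv ℝ G (p, (θ : Coord n))) :=
      hG'.comp_continuous (f := fun θ : Metric.sphere (0 : Coord n) 1 => (p, (θ : Coord n)))
        (by fun_prop) (fun θ => ⟨hp, ne_zero_of_mem_unit_sphere θ⟩)
    exact (h1.clm_comp continuous_const).aestronglyMeasurable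
  · refine Eventually.of_forall (fun θ q hq => ?_)
    refine (ContinuousLinearMap.opNorm_comp_le _ _).trans ?_
    exact mul_le_mul_of_nonneg_right (hC (q, θ) ⟨Metric.ball_subset_closedBall hq, θ.2⟩)
      (norm_nonneg _)
  · refine Eventually.of_forall (fun θ q hq => ?_)
    have hz : (q, (θ : Coord n)) ∈ O := hsub ⟨Metric.ball_subset_closedBall hq, θ.2⟩
    have h1 : HasFDerivAt G (fderiv ℝ G (q, θ)) (q, (θ : Coord n)) :=
      ((hGd.contDiffAt (hL.isOpen_prod.mem_nhds hz)).differentiableAt (by norm_num)).hasFDerivAt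
    exact HasFDerivAt.comp (g := G) (f := fun e => (e, (θ : Coord n))) q h1
      (hasFDerivAt_prodMk_left q _)

/-- The volume of the unit balls changes by the expected factor under a linear map which
multiplies `L` by a constant. -/
lemma volume_ball_of_comp_linear (hL : IsFinslerOn L U) {q v : Coord n} (hp : p ∈ U)
    (hv : v ≠ 0) (A : Coord n →ₗ[ℝ] Coord n) (hA : LinearMap.det A ≠ 0)
    {k : ℝ} (hk : 0 < k) (h : ∀ w, L q (A w) = k * L p w) :
    k ^ n * volume.real {w : Coord n | L q w ≤ 1}
      = |LinearMap.det A| * volume.real {w : Coord n | L p w ≤ 1} := by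
  have hkdet : LinearMap.det (k • (LinearMap.id : Coord n →ₗ[ℝ] Coord n)) = k ^ n := by
    simp [LinearMap.det_smul]
  have hkn : 0 < k ^ n := pow_pos hk n
  have hset : A ⁻¹' {w : Coord n | L q w ≤ 1}
      = (k • (LinearMap.id : Coord n →ₗ[ℝ] Coord n)) ⁻¹' {w : Coord n | L p w ≤ 1} := by
    ext w
    simp only [Set.mem_preimage, Set.mem_ofPred_eq, h, LinearMap.smul_apply, LinearMap.id_apply]
    rcases eq_or_ne w 0 with rfl | hw
    · simp [hL.apply_zero hp hv]
    · rw [hL.homogeneous p hp w hw k hk.le]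
  have h1 := congrArg (fun s => (volume s).toReal) hset
  simp only [Measure.addHaar_preimage_linearMap volume hA] at h1
  rw [Measure.addHaar_preimage_linearMap volume (by rw [hkdet]; exact hkn.ne'), hkdet,
    ENNReal.toReal_mul, ENNReal.toReal_mul, ENNReal.toReal_ofReal (abs_nonneg _),
    ENNReal.toReal_ofReal (abs_nonneg _), abs_inv, abs_inv, abs_of_pos hkn] at h1
  have hA' : 0 < |LinearMap.det A| := abs_pos.mpr hA
  rw [Measure.real, Measure.real]
  field_simp at h1
  linarith

end IsFinslerOn

/-! ### Flows of homothetic fields in coordinates -/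

section Flow

variable {E : Type*} [NormedAddCommGroup E] [NormedSpace ℝ E]

/-- The derivative at `t = 0` of the curve `(ψ_t(p), (ψ_t)_* v)`, where `ψ_t` is the flow of the
vector field `V`: the equality of mixed partial derivatives turns the second component into the
derivative of `V` in the direction `v`. -/
lemma hasDerivAt_flow_tangent {ψ : ℝ × E → E} {V : E → E} {p : E}
    (hψ : ContDiffAt ℝ 2 ψ (0, p)) (hV : DifferentiableAt ℝ V p)
    (hder : ∀ᶠ q in 𝓝 p, HasDerivAt (fun t => ψ (t, q)) (V q) 0) (v : E) :
    HasDerivAt (fun t : ℝ => (ψ (t, p), fderiv ℝ (fun q => ψ (t, q)) p v))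
      (V p, fderiv ℝ V p v) 0 := by
  refine hder.self_of_nhds.prodMk ?_
  have hD : DifferentiableAt ℝ (fderiv ℝ ψ) (0, p) :=
    (hψ.fderiv_right (m := 1) (by norm_num)).differentiableAt (by norm_num)
  have hline : Tendsto (fun t : ℝ => (t, p)) (𝓝 0) (𝓝 (0, p)) :=
    (Continuous.prodMk_left p).tendsto 0
  have hline' : Tendsto (fun q : E => ((0 : ℝ), q)) (𝓝 p) (𝓝 (0, p)) :=
    (Continuous.prodMk_right (0 : ℝ)).tendsto p
  have hev1 : (fun t : ℝ => fderiv ℝ (fun q => ψ (t, q)) p v)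
      =ᶠ[𝓝 0] fun t => fderiv ℝ ψ (t, p) (0, v) := by
    filter_upwards [hline.eventually (hψ.eventually (by norm_num))] with t ht
    have h1 := HasFDerivAt.comp (g := ψ) (f := fun q => (t, q)) p
      (ht.differentiableAt (by norm_num)).hasFDerivAt (hasFDerivAt_prodMk_right t p)
    have h2 : fderiv ℝ (fun q => ψ (t, q)) p = _ := h1.fderiv
    rw [h2]
    simp
  have hev2 : (fun q : E => fderiv ℝ ψ (0, q) (1, 0)) =ᶠ[𝓝 p] V := by
    filter_upwards [hline'.eventually (hψ.eventually (by norm_num)), hder] with q hq hq'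
    have h1 := HasFDerivAt.comp_hasDerivAt (l := ψ) (f := fun t : ℝ => (t, q)) (0 : ℝ)
      (hq.differentiableAt (by norm_num)).hasFDerivAt
      ((hasDerivAt_id (0 : ℝ)).prodMk (hasDerivAt_const (0 : ℝ) q))
    exact h1.unique hq'
  have hmixed : fderiv ℝ (fderiv ℝ ψ) (0, p) (0, v) (1, 0) = fderiv ℝ V p v := by
    have h1 := HasFDerivAt.comp (g := fun z => fderiv ℝ ψ z (1, 0))
      (f := fun q : E => ((0 : ℝ), q)) p
      (hD.hasFDerivAt.clm_apply (hasFDerivAt_const ((1 : ℝ), (0 : E)) _))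
      (hasFDerivAt_prodMk_right (0 : ℝ) p)
    have h2 := (hV.hasFDerivAt.congr_of_eventuallyEq hev2).unique h1
    rw [h2]
    simp
  have hsymm : fderiv ℝ (fderiv ℝ ψ) (0, p) (1, 0) (0, v)
      = fderiv ℝ (fderiv ℝ ψ) (0, p) (0, v) (1, 0) :=
    (hψ.isSymmSndFDerivAt (by simp)).eq _ _
  have h3 := HasFDerivAt.comp_hasDerivAt (l := fun z => fderiv ℝ ψ z (0, v))
    (f := fun t : ℝ => (t, p)) (0 : ℝ)
    (hD.hasFDerivAt.clm_apply (hasFDerivAt_const ((0 : ℝ), v) _))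
    ((hasDerivAt_id (0 : ℝ)).prodMk (hasDerivAt_const (0 : ℝ) p))
  refine HasDerivAt.congr_of_eventuallyEq ?_ hev1
  rw [← hmixed, ← hsymm]
  refine h3.congr_deriv ?_
  simp

lemma flow_tangent_zero {ψ : ℝ × E → E} {p : E} (h0 : ∀ᶠ q in 𝓝 p, ψ (0, q) = q) (v : E) :
    (ψ (0, p), fderiv ℝ (fun q => ψ (0, q)) p v) = (p, v) := by
  have : fderiv ℝ (fun q => ψ (0, q)) p = ContinuousLinearMap.id ℝ _ :=
    ((hasFDerivAt_id p).congr_of_eventuallyEq h0).fderiv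
  rw [this, h0.self_of_nhds]; rfl

end Flow

namespace IsFinslerOn

variable {n : ℕ} {L : Coord n → Coord n → ℝ} {U : Set (Coord n)} {p v : Coord n}
  {V : Coord n → Coord n} {ψ : ℝ × Coord n → Coord n} {c : ℝ}

/-- The infinitesimal form of the homothety condition. -/
lemma fderiv_homothetic (hL : IsFinslerOn L U) (hp : p ∈ U) (hv : v ≠ 0)
    (hψ : ContDiffAt ℝ 2 ψ (0, p)) (hV : DifferentiableAt ℝ V p)
    (h0 : ∀ᶠ q in 𝓝 p, ψ (0, q) = q)
    (hder : ∀ᶠ q in 𝓝 p, HasDerivAt (fun t => ψ (t, q)) (V q) 0)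
    (hflow : ∀ᶠ t : ℝ in 𝓝 0, ∀ w,
      L (ψ (t, p)) (fderiv ℝ (fun q => ψ (t, q)) p w) = Real.exp (-2 * c * t) * L p w) :
    fderiv ℝ (Function.uncurry L) (p, v) (V p, fderiv ℝ V p v) = -2 * c * L p v := by
  have hγ := hasDerivAt_flow_tangent hψ hV hder v
  have hγ0 := flow_tangent_zero h0 v
  have hd := (hL.differentiableAt hp hv).hasFDerivAt
  rw [← hγ0] at hd
  have h1 := hd.comp_hasDerivAt (0 : ℝ) hγ
  rw [hγ0] at h1
  have h2 : HasDerivAt (fun t : ℝ => Real.exp (-2 * c * t) * L p v) (-2 * c * L p v) 0 := by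
    have := (((hasDerivAt_id (0 : ℝ)).const_mul (-2 * c)).exp).mul_const (L p v)
    simpa using this
  refine h1.unique (h2.congr_of_eventuallyEq ?_)
  filter_upwards [hflow] with t ht
  exact ht v

/-- The flow of a homothetic field preserves the distortion for the Busemann-Hausdorff measure. -/
lemma fderiv_distortion_homothetic (hL : IsFinslerOn L U) (hp : p ∈ U) (hv : v ≠ 0)
    (hψ : ContDiffAt ℝ 2 ψ (0, p)) (hV : DifferentiableAt ℝ V p)
    (h0 : ∀ᶠ q in 𝓝 p, ψ (0, q) = q)
    (hder : ∀ᶠ q in 𝓝 p, HasDerivAt (fun t => ψ (t, q)) (V q) 0)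
    (hflow : ∀ᶠ t : ℝ in 𝓝 0, ∀ w,
      L (ψ (t, p)) (fderiv ℝ (fun q => ψ (t, q)) p w) = Real.exp (-2 * c * t) * L p w)
    {σ : Coord n → ℝ} {κ : ℝ} (hσ : ∀ q, σ q = κ / volume.real {w : Coord n | L q w ≤ 1})
    (hτ : DifferentiableAt ℝ (fun q : Coord n × Coord n => distortion L σ q.1 q.2) (p, v)) :
    fderiv ℝ (fun q : Coord n × Coord n => distortion L σ q.1 q.2) (p, v)
      (V p, fderiv ℝ V p v) = 0 := by
  have hγ := hasDerivAt_flow_tangent hψ hV hder v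
  have hn : n ≠ 0 := by
    rintro rfl
    exact hv (Subsingleton.elim _ _)
  have hγ0 := flow_tangent_zero h0 v
  have hd := hτ.hasFDerivAt
  rw [← hγ0] at hd
  have h1 := hd.comp_hasDerivAt (0 : ℝ) hγ
  rw [hγ0] at h1
  refine h1.unique ((hasDerivAt_const (0 : ℝ) (distortion L σ p v)).congr_of_eventuallyEq ?_)
  have hmem : ∀ᶠ t : ℝ in 𝓝 0, ψ (t, p) ∈ U := by
    have hc : ContinuousAt (fun t : ℝ => ψ (t, p)) 0 := hder.self_of_nhds.continuousAt
    refine hc.eventually_mem (hL.isOpen.mem_nhds ?_)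
    rw [h0.self_of_nhds]; exact hp
  filter_upwards [hflow, hmem] with t ht htU
  set q := ψ (t, p) with hq
  set A := fderiv ℝ (fun q => ψ (t, q)) p with hA
  set k := Real.exp (-2 * c * t) with hk
  have hk0 : 0 < k := Real.exp_pos _
  -- The differential of the flow is injective, since `L` vanishes only at the origin.
  have hA0 : ∀ w, w ≠ 0 → A w ≠ 0 := by
    intro w hw h
    have h2 := ht w
    rw [h, hL.apply_zero htU hv] at h2
    have := mul_pos hk0 (hL.pos p hp w hw)
    linarith
  have hdet : LinearMap.det A.toLinearMap ≠ 0 := by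
    intro hdet
    obtain ⟨w, hw, hw0⟩ := Submodule.exists_mem_ne_zero_of_ne_bot
      (LinearMap.bot_lt_ker_of_det_eq_zero hdet).ne'
    exact hA0 w hw0 hw
  have hvol := hL.volume_ball_of_comp_linear (q := q) hp hv A.toLinearMap hdet hk0 ht
  have hpq := hL.volume_ball_pos htU hn
  have hpp := hL.volume_ball_pos hp hn
  refine distortion_of_comp_linear (q := q) A.toLinearMap hk0 hdet (hL.contDiffAt_two hp hv)
    (hL.contDiffAt_two htU (hA0 v hv)) ht ?_
  rw [hσ, hσ]
  field_simp
  linear_combination (-κ) * hvol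

/-- Homogeneity of degree zero of the distortion in the direction, in infinitesimal form. -/
lemma fderiv_distortion_self (hL : IsFinslerOn L U) (hp : p ∈ U) (hv : v ≠ 0) {σ : Coord n → ℝ}
    (hτ : DifferentiableAt ℝ (fun q : Coord n × Coord n => distortion L σ q.1 q.2) (p, v)) :
    fderiv ℝ (fun q : Coord n × Coord n => distortion L σ q.1 q.2) (p, v) (0, v) = 0 := by
  refine (hasDerivAt_comp_vertical_line hτ.hasFDerivAt v).unique
    ((hasDerivAt_const (0 : ℝ) (distortion L σ p v)).congr_of_eventuallyEq ?_)
  filter_upwards [lt_mem_nhds (show (-1 : ℝ) < 0 by norm_num)] with t ht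
  have hr : 0 < 1 + t := by linarith
  have hvt : v + t • v = (1 + t) • v := by rw [add_smul, one_smul]
  rw [hvt]
  refine distortion_smul hr (hL.contDiffAt_two hp hv)
    (hL.contDiffAt_two hp (smul_ne_zero hr.ne' hv)) (fun w => ?_)
  rcases eq_or_ne w 0 with rfl | hw
  · simp [hL.apply_zero hp hv]
  · exact hL.homogeneous p hp w hw _ hr.le

/-- The S-curvature formula for navigation with a homothetic field, in coordinates. -/
theorem coordSCurvature_navigation (hL : IsFinslerOn L U) (hp : p ∈ U) (hv : v ≠ 0)
    (hψ : ContDiffAt ℝ 2 ψ (0, p)) (hV : ContDiffAt ℝ 3 V p)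
    (h0 : ∀ᶠ q in 𝓝 p, ψ (0, q) = q)
    (hder : ∀ᶠ q in 𝓝 p, HasDerivAt (fun t => ψ (t, q)) (V q) 0)
    (hflow : ∀ᶠ t : ℝ in 𝓝 0, ∀ w,
      L (ψ (t, p)) (fderiv ℝ (fun q => ψ (t, q)) p w) = Real.exp (-2 * c * t) * L p w)
    {σ : Coord n → ℝ} {κ : ℝ} (hκ : κ ≠ 0)
    (hσ : ∀ q, σ q = κ / volume.real {w : Coord n | L q w ≤ 1})
    (hcone : fundTensor (L p) v v (V p) < -L p v) {Lt : Coord n → Coord n → ℝ}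
    (hLt : ∀ q ∈ U, ∀ w, w ≠ 0 → fundTensor (L q) w w (V q) < -L q w →
      Lt q (w + L q w • V q) = L q w) :
    coordSCurvature Lt σ p (v + L p v • V p)
      = coordSCurvature L σ p v + ((n : ℝ) + 1) * c * L p v := by
  have hn : n ≠ 0 := by
    rintro rfl
    exact hv (Subsingleton.elim _ _)
  have hVd : DifferentiableAt ℝ V p := hV.differentiableAt (by norm_num)
  have hL3 : ContDiffAt ℝ 3 (Function.uncurry L) (p, v) :=
    (hL.contDiffAt hp hv).of_le ENat.LEInfty.out
  have hcone_iff : ∀ q ∈ U, ∀ w, w ≠ 0 →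
      (fundTensor (L q) w w (V q) < -L q w ↔ navFactor L V (q, w) < 0) := by
    intro q hq w hw
    have := hL.pos q hq w hw
    rw [hL.fundTensor_self_left hq hw, navFactor]
    constructor <;> intro h <;> nlinarith
  have hlam : navFactor L V (p, v) < 0 := (hcone_iff p hp v hv).mp hcone
  have hdet := det_hessMatrix_ne_zero (hL.contDiffAt_two hp hv) (hL.strong_convex p hp v hv)
  have hvol := hL.volume_ball_pos hp hn
  have hσeq : σ = fun q => κ / volume.real {w : Coord n | L q w ≤ 1} := funext hσ
  have hσd : DifferentiableAt ℝ σ p := by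
    rw [hσeq]
    have := ((hL.differentiableAt_volume_ball hp hn).fun_inv hvol.ne').const_mul κ
    simpa [div_eq_mul_inv] using this
  have hσ0 : σ p ≠ 0 := by
    rw [hσ]
    exact div_ne_zero hκ hvol.ne'
  have hτd := differentiableAt_distortion hL3 hdet hσd hσ0
  refine coordSCurvature_navMap hL3 hV hlam.ne ?_ (hL.pos p hp v hv).ne' hdet
    (hL.eventually_euler hp hv) ?_ hσd hσ0
    (hL.fderiv_distortion_homothetic hp hv hψ hVd h0 hder hflow hσ hτd)
    (hL.fderiv_distortion_self hp hv hτd)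
  · filter_upwards [hL.isOpen_prod.mem_nhds ⟨hp, hv⟩,
      (continuousAt_navFactor (z := (p, v)) (hL.contDiffAt_two hp hv) hVd).eventually
        (gt_mem_nhds hlam)] with q hq hq'
    exact hLt q.1 hq.1 q.2 hq.2 ((hcone_iff q.1 hq.1 q.2 hq.2).mpr hq')
  · filter_upwards [isOpen_ne.mem_nhds hv] with w hw
    exact hL.fderiv_homothetic hp hw hψ hVd h0 hder hflow

end IsFinslerOn

/-! ### Finsler metrics and vector fields in a chart -/

section Chart

variable {n : ℕ} {M : Type*} [TopologicalSpace M] [ChartedSpace (Coord n) M]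
  {e : OpenPartialHomeomorph M (Coord n)}

/-- The components of the vector field `V` in the coordinates given by the chart `e`. -/
def fieldInChart (e : OpenPartialHomeomorph M (Coord n))
    (V : ∀ x : M, TangentSpace (𝓡 n) x) (p : Coord n) : Coord n :=
  mfderiv (𝓡 n) (𝓡 n) e (e.symm p) (V (e.symm p))

/-- The differential of the inverse of the chart `e` at `p`, as a linear map from `ℝⁿ`. -/
def symmDeriv (e : OpenPartialHomeomorph M (Coord n)) (p : Coord n) :
    Coord n →ₗ[ℝ] TangentSpace (𝓡 n) (e.symm p) :=
  (mfderiv (𝓡 n) (𝓡 n) e.symm p).toLinearMap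

lemma inChart_eq (F : ∀ x : M, TangentSpace (𝓡 n) x → ℝ) (p v : Coord n) :
    inChart e F p v = F (e.symm p) (symmDeriv e p v) := rfl

/-- Tangent vectors at equal points which have equal components have equal images. Each tangent
space is definitionally `ℝⁿ`, so no transport along `a = b` occurs in the statement. -/
lemma apply_congr (F : ∀ x : M, TangentSpace (𝓡 n) x → ℝ) {a b : M} (h : a = b)
    {u w : Coord n} (huw : u = w) : F a u = F b w := by
  subst h; subst huw; rfl

lemma tangent_mk_congr {a b : M} (h : a = b) {u w : Coord n} (huw : u = w) :
    (⟨a, u⟩ : TangentBundle (𝓡 n) M) = ⟨b, w⟩ := by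
  subst h; subst huw; rfl

lemma chart_mdifferentiable (he : e ∈ IsManifold.maximalAtlas (𝓡 n) ∞ M) :
    e.MDifferentiable (𝓡 n) (𝓡 n) :=
  ⟨(contMDiffOn_of_mem_maximalAtlas he).mdifferentiableOn (by simp),
    (contMDiffOn_symm_of_mem_maximalAtlas he).mdifferentiableOn (by simp)⟩

lemma mfderiv_symmDeriv (he : e ∈ IsManifold.maximalAtlas (𝓡 n) ∞ M) {p : Coord n}
    (hp : p ∈ e.target) (v : Coord n) :
    (mfderiv (𝓡 n) (𝓡 n) e (e.symm p) (symmDeriv e p v) : Coord n) = v :=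
  congrArg (fun f : Coord n →L[ℝ] Coord n => f v)
    ((chart_mdifferentiable he).comp_symm_deriv hp)

lemma symmDeriv_mfderiv (he : e ∈ IsManifold.maximalAtlas (𝓡 n) ∞ M) {x : M}
    (hx : x ∈ e.source) (y : TangentSpace (𝓡 n) x) :
    (symmDeriv e (e x) (mfderiv (𝓡 n) (𝓡 n) e x y) : Coord n) = (y : Coord n) :=
  congrArg (fun f : Coord n →L[ℝ] Coord n => f y)
    ((chart_mdifferentiable he).symm_comp_deriv hx)

lemma symmDeriv_fieldInChart (he : e ∈ IsManifold.maximalAtlas (𝓡 n) ∞ M)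
    (V : ∀ x : M, TangentSpace (𝓡 n) x) {p : Coord n} (hp : p ∈ e.target) :
    symmDeriv e p (fieldInChart e V p) = V (e.symm p) := by
  have h := symmDeriv_mfderiv he (e.map_target hp) (V (e.symm p))
  rw [e.right_inv hp] at h
  exact h

lemma symmDeriv_ne_zero (he : e ∈ IsManifold.maximalAtlas (𝓡 n) ∞ M) {p : Coord n}
    (hp : p ∈ e.target) {v : Coord n} (hv : v ≠ 0) : symmDeriv e p v ≠ 0 := by
  intro h
  apply hv
  rw [← mfderiv_symmDeriv he hp v, h]
  exact map_zero (mfderiv (𝓡 n) (𝓡 n) e (e.symm p))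

lemma fundTensor_inChart (F : ∀ x : M, TangentSpace (𝓡 n) x → ℝ) (p y u v : Coord n) :
    fundTensor (F (e.symm p)) (symmDeriv e p y) (symmDeriv e p u) (symmDeriv e p v)
      = fundTensor (inChart e F p) y u v := by
  have := fundTensor_comp_linear (N := inChart e F p) (N' := F (e.symm p)) (symmDeriv e p) (k := 1)
    (fun w => by rw [one_mul, inChart_eq]) y u v
  simpa using this

lemma inChart_apply (he : e ∈ IsManifold.maximalAtlas (𝓡 n) ∞ M)
    (F : ∀ x : M, TangentSpace (𝓡 n) x → ℝ) {x : M} (hx : x ∈ e.source)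
    (y : TangentSpace (𝓡 n) x) :
    inChart e F (e x) (mfderiv (𝓡 n) (𝓡 n) e x y) = F x y :=
  apply_congr F (e.left_inv hx) (symmDeriv_mfderiv he hx y)

variable [IsManifold (𝓡 n) ∞ M]

/-- The tangent map of the inverse of a chart, as a map from `ℝⁿ × ℝⁿ`, is smooth. -/
lemma contMDiffOn_symm_tangent (he : e ∈ IsManifold.maximalAtlas (𝓡 n) ∞ M) :
    ContMDiffOn 𝓘(ℝ, Coord n × Coord n) (𝓡 n).tangent ∞
      (fun z : Coord n × Coord n =>
        (⟨e.symm z.1, symmDeriv e z.1 z.2⟩ : TangentBundle (𝓡 n) M))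
      (e.target ×ˢ Set.univ) := by
  have : IsManifold (𝓡 n) 1 M := IsManifold.of_le (n := ∞) (by simp)
  have h1 := (contMDiffOn_symm_of_mem_maximalAtlas he).contMDiffOn_tangentMapWithin
    (m := ∞) (by simp) e.open_target.uniqueMDiffOn
  have h2 : ContMDiff 𝓘(ℝ, Coord n × Coord n) (𝓡 n).tangent ∞
      (fun z : Coord n × Coord n => (⟨z.1, z.2⟩ : TangentBundle (𝓡 n) (Coord n))) := by
    rw [modelWithCornersSelf_prod]
    exact contMDiff_tangentBundleModelSpaceHomeomorph_symm
  have h3 := h1.comp (h2.contMDiffOn (s := (e.target ×ˢ Set.univ : Set (Coord n × Coord n))))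
    (fun z hz => hz.1)
  refine h3.congr (fun z hz => ?_)
  refine tangent_mk_congr rfl ?_
  have := mfderivWithin_of_isOpen (I := 𝓡 n) (I' := 𝓡 n) (f := e.symm) e.open_target hz.1
  exact congrArg (fun f : Coord n →L[ℝ] Coord n => f z.2) this.symm

/-- A Finsler metric, expressed in a chart. -/
lemma isFinslerOn_inChart (he : e ∈ IsManifold.maximalAtlas (𝓡 n) ∞ M)
    {F : ∀ x : M, TangentSpace (𝓡 n) x → ℝ} (hF : IsFinslerMetric F) :
    IsFinslerOn (inChart e F) e.target where
  isOpen := e.open_target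
  contDiffOn := by
    rw [← contMDiffOn_iff_contDiffOn]
    exact hF.smooth.comp ((contMDiffOn_symm_tangent he).mono
      (Set.prod_mono le_rfl (Set.subset_univ _))) (fun z hz => symmDeriv_ne_zero he hz.1 hz.2)
  pos p hp v hv := hF.pos _ _ (symmDeriv_ne_zero he hp hv)
  homogeneous p hp v hv r hr := by
    rw [inChart_eq, inChart_eq, map_smul]
    exact hF.homogeneous _ _ (symmDeriv_ne_zero he hp hv) r hr
  strong_convex p hp v hv u hu := by
    rw [← fundTensor_inChart]
    exact hF.strong_convex _ _ (symmDeriv_ne_zero he hp hv) _ (symmDeriv_ne_zero he hp hu)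

lemma contDiffOn_fieldInChart (he : e ∈ IsManifold.maximalAtlas (𝓡 n) ∞ M)
    {V : ∀ x : M, TangentSpace (𝓡 n) x}
    (hV : ContMDiff (𝓡 n) (𝓡 n).tangent ∞ (fun x => (⟨x, V x⟩ : TangentBundle (𝓡 n) M))) :
    ContDiffOn ℝ ∞ (fieldInChart e V) e.target := by
  have : IsManifold (𝓡 n) 1 M := IsManifold.of_le (n := ∞) (by simp)
  have h1 := (contMDiffOn_of_mem_maximalAtlas he).contMDiffOn_tangentMapWithin
    (m := ∞) (by simp) e.open_source.uniqueMDiffOn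
  have h2 := h1.comp (hV.comp_contMDiffOn (contMDiffOn_symm_of_mem_maximalAtlas he))
    (fun p hp => e.map_target hp)
  have h3 := (contMDiff_snd_tangentBundle_modelSpace (Coord n) (𝓡 n)).comp_contMDiffOn h2
  rw [← contMDiffOn_iff_contDiffOn]
  refine h3.congr (fun p hp => ?_)
  have := mfderivWithin_of_isOpen (I := 𝓡 n) (I' := 𝓡 n) (f := e) e.open_source (e.map_target hp)
  exact congrArg (fun f : Coord n →L[ℝ] Coord n => f (V (e.symm p))) this.symm

/-- The metric induced by navigation takes the prescribed values: the vector `y` in its definition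
is unique. -/
lemma inChart_navMetric (he : e ∈ IsManifold.maximalAtlas (𝓡 n) ∞ M)
    {F : ∀ x : M, TangentSpace (𝓡 n) x → ℝ} (hF : IsFinslerMetric F)
    (V : ∀ x : M, TangentSpace (𝓡 n) x) {p : Coord n} (hp : p ∈ e.target) {w : Coord n}
    (hw : w ≠ 0)
    (hcone : fundTensor (inChart e F p) w w (fieldInChart e V p) < -inChart e F p w) :
    inChart e (navMetric F V) p (w + inChart e F p w • fieldInChart e V p) = inChart e F p w := by
  have hL := isFinslerOn_inChart he hF
  have hVp := symmDeriv_fieldInChart he V hp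
  have hex : ∃ y ∈ navCone F V (e.symm p),
      symmDeriv e p (w + inChart e F p w • fieldInChart e V p)
        = y + F (e.symm p) y • V (e.symm p) := by
    refine ⟨symmDeriv e p w, ⟨symmDeriv_ne_zero he hp hw, ?_⟩, ?_⟩
    · rw [← hVp, fundTensor_inChart]
      exact hcone
    · rw [map_add, map_smul, hVp, inChart_eq]
  rw [inChart_eq, navMetric, dif_pos hex]
  obtain ⟨hmem, heq⟩ := hex.choose_spec
  set y := hex.choose with hy
  -- The coordinates of the vector chosen in the definition of `navMetric`.
  set w' : Coord n := mfderiv (𝓡 n) (𝓡 n) e (e.symm p) y with hw'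
  have hyw' : symmDeriv e p w' = y := by
    have h := symmDeriv_mfderiv he (e.map_target hp) y
    rw [e.right_inv hp] at h
    exact h
  have hw'0 : w' ≠ 0 := by
    intro h
    apply hmem.1
    rw [← hyw', h, map_zero]
  have hcone' : fundTensor (inChart e F p) w' w' (fieldInChart e V p) < -inChart e F p w' := by
    rw [← fundTensor_inChart, hyw', hVp, inChart_eq, hyw']
    exact hmem.2
  have hlt : ∀ u : Coord n, u ≠ 0 →
      fundTensor (inChart e F p) u u (fieldInChart e V p) < -inChart e F p u →
      vertDeriv (inChart e F) (p, u) (fieldInChart e V p) < -1 := by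
    intro u hu h
    rw [hL.fundTensor_self_left hp hu] at h
    have := hL.pos p hp u hu
    nlinarith
  have hinj : w = w' := by
    refine hL.navigation_unique hp (V := fieldInChart e V p) hw hw'0 (hlt w hw hcone)
      (hlt w' hw'0 hcone') ?_
    have h1 := congrArg (fun u => (mfderiv (𝓡 n) (𝓡 n) e (e.symm p) u : Coord n)) heq
    refine (mfderiv_symmDeriv he hp _).symm.trans (h1.trans ?_)
    rw [inChart_eq F p w', hyw']
    exact ((mfderiv (𝓡 n) (𝓡 n) e (e.symm p)).map_add _ _).trans
      (congrArg (w' + ·) ((mfderiv (𝓡 n) (𝓡 n) e (e.symm p)).map_smul _ _))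
  rw [hinj, inChart_eq, hyw']

end Chart

/-! ### Homothetic flows in a chart and the S-curvature on the manifold -/

section HomotheticFlow

variable {n : ℕ} {M : Type*} [TopologicalSpace M] [ChartedSpace (Coord n) M]
  {e : OpenPartialHomeomorph M (Coord n)}

/-- The local flow of a homothetic field, expressed in a chart. -/
lemma exists_flow_inChart (he : e ∈ IsManifold.maximalAtlas (𝓡 n) ∞ M)
    {F : ∀ x : M, TangentSpace (𝓡 n) x → ℝ} {V : ∀ x : M, TangentSpace (𝓡 n) x} {c : ℝ}
    (hc : IsHomothetic F V c) {p : Coord n} (hp : p ∈ e.target) :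
    ∃ ψ : ℝ × Coord n → Coord n, ContDiffAt ℝ 2 ψ (0, p) ∧
      (∀ᶠ q in 𝓝 p, ψ (0, q) = q) ∧
      (∀ᶠ q in 𝓝 p, HasDerivAt (fun t => ψ (t, q)) (fieldInChart e V q) 0) ∧
      ∀ᶠ t : ℝ in 𝓝 0, ∀ w, inChart e F (ψ (t, p)) (fderiv ℝ (fun q => ψ (t, q)) p w)
        = Real.exp (-2 * c * t) * inChart e F p w := by
  obtain ⟨U, ε, Ψ, hU, hxU, hε, hΨ, hΨ0, hint, hhom⟩ := hc (e.symm p)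
  have hI : Set.Ioo (-ε) ε ∈ 𝓝 (0 : ℝ) := Ioo_mem_nhds (by linarith) hε
  have hI0 : (0 : ℝ) ∈ Set.Ioo (-ε) ε := ⟨by linarith, hε⟩
  have hes : ContMDiffOn (𝓡 n) (𝓡 n) ∞ e.symm e.target := contMDiffOn_symm_of_mem_maximalAtlas he
  have hef : ContMDiffOn (𝓡 n) (𝓡 n) ∞ e e.source := contMDiffOn_of_mem_maximalAtlas he
  have hmd := chart_mdifferentiable he
  have hescont : ContinuousAt e.symm p := e.symm.continuousAt hp
  have hUev : ∀ᶠ q in 𝓝 p, e.symm q ∈ U := hescont.eventually_mem (hU.mem_nhds hxU)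
  have htarget : ∀ᶠ q in 𝓝 p, q ∈ e.target := e.open_target.mem_nhds hp
  have hψ0 : ∀ q ∈ e.target, e.symm q ∈ U → e (Ψ 0 (e.symm q)) = q := by
    intro q hq hqU
    rw [hΨ0 _ hqU, e.right_inv hq]
  have hΨx : ∀ t ∈ Set.Ioo (-ε) ε, ∀ x ∈ U, ContMDiffAt (𝓘(ℝ, ℝ).prod (𝓡 n)) (𝓡 n) ∞
      (fun z : ℝ × M => Ψ z.1 z.2) (t, x) := fun t ht x hx =>
    hΨ.contMDiffAt ((isOpen_Ioo.prod hU).mem_nhds ⟨ht, hx⟩)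
  have hx0 : Ψ 0 (e.symm p) = e.symm p := hΨ0 _ hxU
  refine ⟨fun z => e (Ψ z.1 (e.symm z.2)), ?_, ?_, ?_, ?_⟩
  · have h1 : ContMDiffAt (𝓘(ℝ, ℝ).prod (𝓡 n)) (𝓘(ℝ, ℝ).prod (𝓡 n)) ∞
        (fun z : ℝ × Coord n => (z.1, e.symm z.2)) (0, p) :=
      contMDiffAt_fst.prodMk
        ((hes.contMDiffAt (e.open_target.mem_nhds hp)).comp ((0 : ℝ), p) contMDiffAt_snd)
    have h2 : ContMDiffAt (𝓘(ℝ, ℝ).prod (𝓡 n)) (𝓡 n) ∞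
        (fun z : ℝ × Coord n => Ψ z.1 (e.symm z.2)) (0, p) :=
      (hΨx 0 hI0 _ hxU).comp ((0 : ℝ), p) h1
    have h3 : ContMDiffAt (𝓡 n) (𝓡 n) ∞ e (Ψ 0 (e.symm p)) := by
      rw [hx0]
      exact hef.contMDiffAt (e.open_source.mem_nhds (e.map_target hp))
    have h4 : ContMDiffAt (𝓘(ℝ, ℝ).prod (𝓡 n)) (𝓡 n) ∞
        (fun z : ℝ × Coord n => e (Ψ z.1 (e.symm z.2))) (0, p) :=
      ContMDiffAt.comp (g := e) (f := fun z : ℝ × Coord n => Ψ z.1 (e.symm z.2)) ((0 : ℝ), p) h3 h2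
    rw [← modelWithCornersSelf_prod, chartedSpaceSelf_prod, contMDiffAt_iff_contDiffAt] at h4
    exact h4.of_le ENat.LEInfty.out
  · filter_upwards [htarget, hUev] with q hq hqU
    exact hψ0 q hq hqU
  · filter_upwards [htarget, hUev] with q hq hqU
    have h1 := (hint _ hqU 0 hI0).hasMFDerivAt hI
    have hq0 : Ψ 0 (e.symm q) = e.symm q := hΨ0 _ hqU
    have h2 : HasMFDerivAt (𝓡 n) (𝓡 n) e (Ψ 0 (e.symm q))
        (mfderiv (𝓡 n) (𝓡 n) e (Ψ 0 (e.symm q))) := by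
      rw [hq0]
      exact (hmd.mdifferentiableAt (e.map_target hq)).hasMFDerivAt
    let B : Coord n →L[ℝ] Coord n := mfderiv (𝓡 n) (𝓡 n) e (Ψ 0 (e.symm q))
    let w : Coord n := V (Ψ 0 (e.symm q))
    have h3 : HasFDerivAt (fun t : ℝ => e (Ψ t (e.symm q)))
        (B.comp (ContinuousLinearMap.smulRight (1 : ℝ →L[ℝ] ℝ) w)) 0 :=
      hasMFDerivAt_iff_hasFDerivAt.mp (HasMFDerivAt.comp (0 : ℝ) h2 h1)
    refine h3.hasDerivAt.congr_deriv ?_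
    have h4 : ∀ {a b : M} (_ : a = b), (mfderiv (𝓡 n) (𝓡 n) e a (V a) : Coord n)
        = mfderiv (𝓡 n) (𝓡 n) e b (V b) := by
      rintro a _ rfl; rfl
    refine Eq.trans ?_ (h4 hq0)
    change B ((1 : ℝ) • w) = B w
    rw [one_smul]
  · have hcont : ContinuousAt (fun t => Ψ t (e.symm p)) 0 :=
      ((hint _ hxU 0 hI0).hasMFDerivAt hI).continuousAt
    have hsrc : ∀ᶠ t : ℝ in 𝓝 0, Ψ t (e.symm p) ∈ e.source :=
      hcont.eventually_mem (e.open_source.mem_nhds (by rw [hx0]; exact e.map_target hp))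
    filter_upwards [hsrc, hI] with t ht htI w
    set x := Ψ t (e.symm p) with hx
    have h1 : HasMFDerivAt (𝓡 n) (𝓡 n) (Ψ t) (e.symm p)
        (mfderiv (𝓡 n) (𝓡 n) (Ψ t) (e.symm p)) := by
      have h := (hΨx t htI _ hxU).comp (e.symm p)
        (contMDiffAt_const.prodMk contMDiffAt_id : ContMDiffAt (𝓡 n) (𝓘(ℝ, ℝ).prod (𝓡 n)) ∞
          (fun y : M => (t, y)) (e.symm p))
      exact (h.mdifferentiableAt (by simp)).hasMFDerivAt
    have h2 := (hmd.mdifferentiableAt_symm hp).hasMFDerivAt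
    have h3 := (hmd.mdifferentiableAt ht).hasMFDerivAt
    let B : Coord n →L[ℝ] Coord n := mfderiv (𝓡 n) (𝓡 n) e x
    let B' : Coord n →L[ℝ] Coord n := mfderiv (𝓡 n) (𝓡 n) (Ψ t) (e.symm p)
    let A : Coord n →L[ℝ] Coord n := mfderiv (𝓡 n) (𝓡 n) e.symm p
    have h4 : HasFDerivAt (fun q : Coord n => e (Ψ t (e.symm q))) (B.comp (B'.comp A)) p :=
      hasMFDerivAt_iff_hasFDerivAt.mp
        (HasMFDerivAt.comp p h3 (HasMFDerivAt.comp p h1 h2))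
    have h5 : fderiv ℝ (fun q => e (Ψ t (e.symm q))) p = _ := h4.fderiv
    change inChart e F (e x) (fderiv ℝ (fun q => e (Ψ t (e.symm q))) p w) = _
    rw [h5]
    exact (inChart_apply he F ht _).trans (hhom t htI _ hxU _)

end HomotheticFlow

end FinslerNavigation

end

theorem lemma2p5 {n : ℕ} {M : Type*} [TopologicalSpace M]
    [ChartedSpace (FinslerNavigation.Coord n) M] [IsManifold (𝓡 n) ∞ M]
    (F : ∀ x : M, TangentSpace (𝓡 n) x → ℝ) (hF : FinslerNavigation.IsFinslerMetric F)
    (V : ∀ x : M, TangentSpace (𝓡 n) x)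
    (hV : ContMDiff (𝓡 n) (𝓡 n).tangent ∞ (fun x => (⟨x, V x⟩ : TangentBundle (𝓡 n) M)))
    (c : ℝ) (hc : FinslerNavigation.IsHomothetic F V c)
    (hnav : ∀ x : M, 1 < F x (-V x))
    (x : M) (y : TangentSpace (𝓡 n) x) (hy : y ≠ 0)
    (hyV : FinslerNavigation.fundTensor (F x) y y (V x) < -F x y)
    (e : OpenPartialHomeomorph M (FinslerNavigation.Coord n))
    (he : e ∈ IsManifold.maximalAtlas (𝓡 n) ∞ M) (hx : x ∈ e.source) :
    FinslerNavigation.sCurvature e (FinslerNavigation.navMetric F V)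
        (FinslerNavigation.bhDensity e F) x (y + F x y • V x)
      = FinslerNavigation.sCurvature e F (FinslerNavigation.bhDensity e F) x y
        + ((n : ℝ) + 1) * c * F x y := by
  have hp : e x ∈ e.target := e.map_source hx
  set v : FinslerNavigation.Coord n := mfderiv (𝓡 n) (𝓡 n) e x y with hv
  have hL := FinslerNavigation.isFinslerOn_inChart he hF
  have hsymm := FinslerNavigation.symmDeriv_mfderiv he hx y
  have hv0 : v ≠ 0 := by
    intro h
    apply hy
    rw [← hv, h] at hsymm
    exact hsymm.symm.trans (map_zero (FinslerNavigation.symmDeriv e (e x)))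
  have hLv : FinslerNavigation.inChart e F (e x) v = F x y :=
    FinslerNavigation.inChart_apply he F hx y
  have hVx : FinslerNavigation.fieldInChart e V (e x) = mfderiv (𝓡 n) (𝓡 n) e x (V x) := by
    rw [FinslerNavigation.fieldInChart, e.left_inv hx]
  obtain ⟨ψ, hψ, h0, hder, hflow⟩ := FinslerNavigation.exists_flow_inChart he hc hp
  have hball : MeasureTheory.volume.real {v : FinslerNavigation.Coord n | ‖v‖ ≤ 1} ≠ 0 := by
    have hset : {v : FinslerNavigation.Coord n | ‖v‖ ≤ 1} = Metric.closedBall 0 1 := by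
      ext u; simp
    rw [hset, MeasureTheory.Measure.real]
    exact (ENNReal.toReal_pos (Metric.measure_closedBall_pos _ _ one_pos).ne'
      (isCompact_closedBall _ _).measure_lt_top.ne).ne'
  have hcone : FinslerNavigation.fundTensor (FinslerNavigation.inChart e F (e x)) v v
      (FinslerNavigation.fieldInChart e V (e x)) < -FinslerNavigation.inChart e F (e x) v := by
    rw [hLv, hVx]
    refine lt_of_eq_of_lt ?_ hyV
    have hcomp := FinslerNavigation.fundTensor_comp_linear (N := F x)
      (N' := FinslerNavigation.inChart e F (e x)) (mfderiv (𝓡 n) (𝓡 n) e x).toLinearMap (k := 1)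
      (fun w => by rw [one_mul]; exact FinslerNavigation.inChart_apply he F hx w) y y (V x)
    rw [one_pow, one_mul] at hcomp
    exact hcomp
  have hmain := hL.coordSCurvature_navigation hp hv0 hψ
    (((FinslerNavigation.contDiffOn_fieldInChart he hV).contDiffAt
      (e.open_target.mem_nhds hp)).of_le ENat.LEInfty.out) h0 hder hflow hball
    (σ := FinslerNavigation.bhDensity e F) (fun q => rfl) hcone
    (Lt := FinslerNavigation.inChart e (FinslerNavigation.navMetric F V))
    (fun q hq w hw h => FinslerNavigation.inChart_navMetric he hF V hq hw h)
  have htilde : (mfderiv (𝓡 n) (𝓡 n) e x (y + F x y • V x) : FinslerNavigation.Coord n)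
      = v + FinslerNavigation.inChart e F (e x) v • FinslerNavigation.fieldInChart e V (e x) := by
    rw [hLv, hVx, map_add, map_smul]
    rfl
  rw [hLv] at hmain htilde
  unfold FinslerNavigation.sCurvature
  rw [htilde]
  exact hmain
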